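/- Throughout, subcategories are full (not assumed closed under isomorphism unless stated). All categories are essentially small. Let $n\ge 1$ be odd, and let $\mathcal C$ be a category of one of the types below, with its *conflations* $X_0\to X_1\to\cdots\to X_n\to X_{n+1}$: * $\mathcal C$ triangulated ($n=1$): the sequences $X_0\to X_1\to X_2$ that extend to a distinguished triangle; * $\mathcal C$ $(n+2)$-angulated (Geiss–Keller–Oppermann) with autoequivalence $\Sigma$: the sequences that extend to a distinguished $(n+2)$-angle $X_0\to\cdots\to X_{n+1}\to\Sigma X_0$; * $\mathcal C$ exact (Quillen; $n=1$): the admissible short exact sequences; * $\mathcal C$ extriangulated (Nakaoka–Palu; $n=1$): the sequences realizing an extension; * $\mathcal C$ $n$-exact (Jasso): the admissible $n$-exact sequences. The *Grothendieck group* $K_0(\mathcal C)$ is the free abelian group on the isomorphism classes $\langle A\rangle$ of objects modulo the relations $\sum_{i=0}^{n+1}(-1)^i\langle X_i\rangle=0$ for all conflations; $[A]$ is the class of $A$. For a subgroup $H\le K_0(\mathcal C)$ and a subcategory $\mathcal S$ put $$f(H)=\{A\in\mathcal C\mid [A]\in H\},\qquad g(\mathcal S)=\langle [A]\mid A\in\mathcal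 S\rangle\le K_0(\mathcal C).$$ $\mathcal S$ is *dense* if every object of $\mathcal C$ is a direct summand of an object isomorphic to one in $\mathcal S$, and *complete* if, whenever $n+1$ of the $n+2$ terms of a conflation lie in $\mathcal S$, so does the remaining one. A subcategory $\mathcal G$ (not necessarily additive) is an *$n$-generator* (resp. *$n$-cogenerator*) if each object $A$ admits a conflation $A'\to G_1\to\cdots\to G_n\to A$ (resp. $A\to G_1\to\cdots\to G_n\to A'$) with all $G_i\in\mathcal G$; for $n=1$ one says *(co)generator*. A subgroup *contains the image of $\mathcal G$* if it contains $g(\mathcal G)$. For $n=1$, $\mathcal S$ is *$\mathcal G$-resolving* (resp. *$\mathcal G$-coresolving*) if it contains $\mathcal G$ and for every conflation $X_0\to X_1\to X_2$: $X_0,X_2\in\mathcal S$ implies $X_1\in\mathcal S$, and $X_1,X_2\in\mathcal S$ implies $X_0\in\mathcal S$ (resp. $X_0,X_1\in\mathcal S$ implies $X_2\in\mathcal S$). An *$(n+2)$-angulated subcategory* of $(\mathcal C,\Sigma)$ is an isomorphism-closed subcategory that is itself $(n+2)$-angulated with respect to the restriction of $\Sigma$ and whose inclusion commutes with $\Sigma$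 and preserves distinguished $(n+2)$-angles. In each of the following cases $f$ and $g$ restrict to mutually inverse bijections. 1. $\mathcal C$ triangulated: between the subgroups of $K_0(\mathcal C)$ and the dense (isomorphism-closed) triangulated subcategories of $\mathcal C$. 2. $\mathcal C$ $(n+2)$-angulated, $n$ odd: between the subgroups of $K_0(\mathcal C)$ and the dense complete $(n+2)$-angulated subcategories of $\mathcal C$. Moreover, every dense complete subcategory of $\mathcal C$ is an $(n+2)$-angulated subcategory. 3. $\mathcal C$ exact with a generator (resp. cogenerator) $\mathcal G$: between the subgroups of $K_0(\mathcal C)$ containing the image of $\mathcal G$ and the dense $\mathcal G$-resolving (resp. $\mathcal G$-coresolving) subcategories of $\mathcal C$. 4. $\mathcal C$ extriangulated with a generator (resp. cogenerator) $\mathcal G$: between the subgroups of $K_0(\mathcal C)$ containing the image of $\mathcal G$ and the dense $\mathcal G$-resolving (resp. $\mathcal G$-coresolving) subcategories of $\mathcal C$. 5. $\mathcal C$ $n$-exact, $n$ odd, with an $n$-generator or $n$-cogenerator $\mathcal G$: between the subgroups of $K_0(\mathcal C)$ containing the image of $\mathcal G$ and the dense complete subcategories of $\mathcal C$ containing $\mathcal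 G$. -/

import Mathlib

open CategoryTheory CategoryTheory.Limits CategoryTheory.Pretriangulated Opposite

universe u v w

noncomputable section

namespace GrothendieckClassification

/-! ## Grothendieck groups and subcategories

The notions of this part depend on a category with a class of conflations only through the
sequences of objects that underlie the conflations. So `E : Set (Fin (n + 2) → C)` is the set of
all families `(X₀, …, Xₙ₊₁)` of terms of a conflation `X₀ ⟶ X₁ ⟶ ⋯ ⟶ Xₙ ⟶ Xₙ₊₁`.
A full subcategory is an `ObjectProperty C`. -/

section General

variable {C : Type u} [Category.{v} C] {n : ℕ}

/-- The Euler relation `⟨X₀⟩ - ⟨X₁⟩ + ⋯ + (-1)ⁿ⁺¹ ⟨Xₙ₊₁⟩` in the free abelian group on the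
isomorphism classes of objects of `C`. -/
def eulerRelation (X : Fin (n + 2) → C) :
    FreeAbelianGroup (Quotient (isIsomorphicSetoid C)) :=
  ∑ i : Fin (n + 2), (-1 : ℤ) ^ (i : ℕ) • FreeAbelianGroup.of (Quotient.mk _ (X i))

/-- The subgroup generated by the Euler relations of all conflations. -/
def eulerSubgroup (E : Set (Fin (n + 2) → C)) :
    AddSubgroup (FreeAbelianGroup (Quotient (isIsomorphicSetoid C))) :=
  AddSubgroup.closure (eulerRelation '' E)

/-- The Grothendieck group `K₀`, for `n` odd (for `n` even one would also kill `⟨0⟩`). -/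
abbrev K0 (E : Set (Fin (n + 2) → C)) : Type u :=
  FreeAbelianGroup (Quotient (isIsomorphicSetoid C)) ⧸ eulerSubgroup E

/-- The class `[A]` of an object in the Grothendieck group. -/
def K0.cls (E : Set (Fin (n + 2) → C)) (A : C) : K0 E :=
  QuotientAddGroup.mk (FreeAbelianGroup.of (Quotient.mk _ A))

/-- The full subcategory of all objects `A` with `[A] ∈ H`. -/
def subcategoryOf {E : Set (Fin (n + 2) → C)} (H : AddSubgroup (K0 E)) : ObjectProperty C :=
  fun A => K0.cls E A ∈ H

/-- The subgroup of `K₀` generated by all `[A]` with `A` in the subcategory `S`. -/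
def subgroupOf (E : Set (Fin (n + 2) → C)) (S : ObjectProperty C) : AddSubgroup (K0 E) :=
  AddSubgroup.closure {x | ∃ A, S A ∧ K0.cls E A = x}

/-- The maps `H ↦ {A | [A] ∈ H}` and `S ↦ ⟨[A] | A ∈ S⟩` are mutually inverse bijections between
the subgroups of `K₀` that contain `H₀` and the subcategories in `𝒮`. -/
def IsClassifiedBy (E : Set (Fin (n + 2) → C)) (𝒮 : Set (ObjectProperty C))
    (H₀ : AddSubgroup (K0 E)) : Prop :=
  Set.MapsTo subcategoryOf {H : AddSubgroup (K0 E) | H₀ ≤ H} 𝒮 ∧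
    Set.MapsTo (subgroupOf E) 𝒮 {H : AddSubgroup (K0 E) | H₀ ≤ H} ∧
    Set.InvOn (subgroupOf E) subcategoryOf {H : AddSubgroup (K0 E) | H₀ ≤ H} 𝒮

/-- Every object of `C` is a direct summand of an object of `S`. -/
def IsDenseSubcategory [Preadditive C] [HasZeroObject C] [HasBinaryBiproducts C] (S : ObjectProperty C) : Prop :=
  ∀ A : C, ∃ A' B : C, S B ∧ Nonempty (B ≅ A ⊞ A')

/-- If all terms of a conflation but one lie in `S`, then so does the remaining one. -/
def IsCompleteSubcategory (E : Set (Fin (n + 2) → C)) (S : ObjectProperty C) : Prop :=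
  ∀ X ∈ E, ∀ j, (∀ i, i ≠ j → S (X i)) → S (X j)

/-- `G` is an `n`-generator: every object `A` has a conflation `A' ⟶ G₁ ⟶ ⋯ ⟶ Gₙ ⟶ A` with all
`Gᵢ` in `G`. The subcategory `G` need not be additive. -/
def IsNGenerator (E : Set (Fin (n + 2) → C)) (G : ObjectProperty C) : Prop :=
  ∀ A : C, ∃ X ∈ E, Nonempty (X (Fin.last (n + 1)) ≅ A) ∧
    ∀ i, i ≠ 0 → i ≠ Fin.last (n + 1) → G (X i)

/-- `G` is an `n`-cogenerator: every object `A` has a conflation `A ⟶ G₁ ⟶ ⋯ ⟶ Gₙ ⟶ A'` with all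
`Gᵢ` in `G`. -/
def IsNCogenerator (E : Set (Fin (n + 2) → C)) (G : ObjectProperty C) : Prop :=
  ∀ A : C, ∃ X ∈ E, Nonempty (X 0 ≅ A) ∧
    ∀ i, i ≠ 0 → i ≠ Fin.last (n + 1) → G (X i)

/-- `S` contains `G` and is closed under extensions and under kernels (cocones) of deflations. -/
def IsResolving (E : Set (Fin (1 + 2) → C)) (G S : ObjectProperty C) : Prop :=
  G ≤ S ∧ (∀ X ∈ E, S (X 0) → S (X 2) → S (X 1)) ∧ (∀ X ∈ E, S (X 1) → S (X 2) → S (X 0))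

/-- `S` contains `G` and is closed under extensions and under cokernels (cones) of inflations. -/
def IsCoresolving (E : Set (Fin (1 + 2) → C)) (G S : ObjectProperty C) : Prop :=
  G ≤ S ∧ (∀ X ∈ E, S (X 0) → S (X 2) → S (X 1)) ∧ (∀ X ∈ E, S (X 0) → S (X 1) → S (X 2))

end General

/-! ## Triangulated categories -/

/-- The terms of the distinguished triangles of a triangulated category. -/
def triangleTerms (C : Type u) [Category.{v} C] [HasZeroObject C] [HasShift C ℤ] [Preadditive C]
    [∀ k : ℤ, (shiftFunctor C k).Additive] [Pretriangulated C] : Set (Fin (1 + 2) → C) :=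
  {X | ∃ T ∈ distTriang C, X = ![T.obj₁, T.obj₂, T.obj₃]}

/-! ## `(n + 2)`-angulated categories -/

section Angulated

variable {C : Type u} [Category.{v} C]

/-- An `(n + 2)`-`T`-sequence `X₀ ⟶ X₁ ⟶ ⋯ ⟶ Xₙ₊₁ ⟶ T X₀`. -/
structure AngleSeq (T : C ⥤ C) (n : ℕ) where
  /-- The first `n + 1` morphisms. -/
  seq : ComposableArrows C (n + 1)
  /-- The last morphism. -/
  δ : seq.obj' (n + 1) ⟶ T.obj (seq.obj' 0)

namespace AngleSeq

variable {T : C ⥤ C} {n : ℕ}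

/-- Morphisms `(φ₀, …, φₙ₊₁)` of `(n + 2)`-`T`-sequences: the last square has `T φ₀` on the
right. -/
@[ext]
structure Hom (X Y : AngleSeq T n) where
  /-- The components. -/
  seq : X.seq ⟶ Y.seq
  comm : X.δ ≫ T.map (ComposableArrows.app' seq 0) =
    ComposableArrows.app' seq (n + 1) ≫ Y.δ

instance : Category (AngleSeq T n) where
  Hom := Hom
  id X := ⟨𝟙 _, by
    dsimp only [ComposableArrows.app', NatTrans.id_app]
    rw [CategoryTheory.Functor.map_id, Category.comp_id]
    exact (Category.id_comp X.δ).symm⟩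
  comp f g := ⟨f.seq ≫ g.seq, by
    have hf := f.comm
    have hg := g.comm
    simp only [ComposableArrows.app', NatTrans.comp_app, Functor.map_comp] at *
    rw [reassoc_of% hf, hg, Category.assoc]⟩

/-- The component `φᵢ` of a morphism. -/
abbrev Hom.app {X Y : AngleSeq T n} (φ : X ⟶ Y) (i : ℕ) (hi : i ≤ n + 1 := by valid) :
    X.seq.obj' i hi ⟶ Y.seq.obj' i hi :=
  ComposableArrows.app' (Hom.seq φ) i hi

/-- `Z` is a direct sum of `X` and `Y`. -/
def IsDirectSum [Preadditive C] (X Y Z : AngleSeq T n) : Prop :=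
  ∃ (inl : X ⟶ Z) (inr : Y ⟶ Z) (fst : Z ⟶ X) (snd : Z ⟶ Y),
    inl ≫ fst = 𝟙 X ∧ inr ≫ snd = 𝟙 Y ∧
      Hom.seq fst ≫ Hom.seq inl + Hom.seq snd ≫ Hom.seq inr = 𝟙 Z.seq

/-- `Y` is (isomorphic to) the left rotation
`X₁ ⟶ X₂ ⟶ ⋯ ⟶ Xₙ₊₁ ⟶ T X₀ ⟶ T X₁` of `X`, with last morphism `(-1)ⁿ⁺² T(d₀) = (-1)ⁿ T(d₀)`. -/
structure LeftRotation [Preadditive C] (X Y : AngleSeq T n) where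
  /-- The identification of `Yᵢ` with `Xᵢ₊₁`. -/
  e : ∀ (i : ℕ) (_ : i ≤ n), Y.seq.obj' i ≅ X.seq.obj' (i + 1)
  /-- The identification of `Yₙ₊₁` with `T X₀`. -/
  e' : Y.seq.obj' (n + 1) ≅ T.obj (X.seq.obj' 0)
  map_e : ∀ (i : ℕ) (hi : i < n), Y.seq.map' i (i + 1) ≫ (e (i + 1) (by lia)).hom =
    (e i (by lia)).hom ≫ X.seq.map' (i + 1) (i + 2)
  map_e' : Y.seq.map' n (n + 1) ≫ e'.hom = (e n le_rfl).hom ≫ X.δ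
  δ_e : Y.δ ≫ T.map (e 0 (by lia)).hom = (-1 : ℤ) ^ n • (e'.hom ≫ T.map (X.seq.map' 0 1))

/-- `Z` is (isomorphic to) the mapping cone
`X₁ ⊕ Y₀ ⟶ X₂ ⊕ Y₁ ⟶ ⋯ ⟶ Xₙ₊₁ ⊕ Yₙ ⟶ T X₀ ⊕ Yₙ₊₁ ⟶ T X₁ ⊕ T Y₀` of `φ : X ⟶ Y`, with
differentials `(x, y) ↦ (-d x, φ x + d y)`. -/
structure MappingCone [Preadditive C] [HasBinaryBiproducts C] {X Y : AngleSeq T n} (φ : X ⟶ Y)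
    (Z : AngleSeq T n) where
  /-- The projection of `Zᵢ` onto `Xᵢ₊₁`. -/
  p : ∀ (i : ℕ) (_ : i ≤ n), Z.seq.obj' i ⟶ X.seq.obj' (i + 1)
  /-- The projection of `Zₙ₊₁` onto `T X₀`. -/
  p' : Z.seq.obj' (n + 1) ⟶ T.obj (X.seq.obj' 0)
  /-- The projection of `Zᵢ` onto `Yᵢ`. -/
  q : ∀ (i : ℕ) (_ : i ≤ n + 1), Z.seq.obj' i ⟶ Y.seq.obj' i
  isIso_lift : ∀ (i : ℕ) (hi : i ≤ n), IsIso (biprod.lift (p i hi) (q i (by lia)))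
  isIso_lift' : IsIso (biprod.lift p' (q (n + 1) le_rfl))
  map_p : ∀ (i : ℕ) (hi : i < n), Z.seq.map' i (i + 1) ≫ p (i + 1) (by lia) =
    -(p i (by lia) ≫ X.seq.map' (i + 1) (i + 2))
  map_p' : Z.seq.map' n (n + 1) ≫ p' = -(p n le_rfl ≫ X.δ)
  map_q : ∀ (i : ℕ) (hi : i ≤ n), Z.seq.map' i (i + 1) ≫ q (i + 1) (Nat.succ_le_succ hi) =
    p i hi ≫ Hom.app φ (i + 1) (Nat.succ_le_succ hi) + q i (Nat.le_succ_of_le hi) ≫ Y.seq.map' i (i + 1)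
  δ_p : Z.δ ≫ T.map (p 0 (by lia)) = -(p' ≫ T.map (X.seq.map' 0 1))
  δ_q : Z.δ ≫ T.map (q 0 (Nat.zero_le _)) = p' ≫ T.map (Hom.app φ 0 (Nat.zero_le _)) +
    q (n + 1) le_rfl ≫ Y.δ

/-- The image of an `(n + 2)`-`T`-sequence under a functor `F` with `T ⋙ F ≅ F ⋙ T'`. -/
def map {D : Type*} [Category* D] {T' : D ⥤ D} (F : C ⥤ D) (η : T ⋙ F ≅ F ⋙ T')
    (X : AngleSeq T n) : AngleSeq T' n where
  seq := X.seq ⋙ F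
  δ := F.map X.δ ≫ η.hom.app _

end AngleSeq

/-- `𝒩` is a class of `(n + 2)`-angles that makes the additive category `C`, with its
autoequivalence `T`, an `(n + 2)`-angulated category in the sense of Geiss, Keller and
Oppermann. -/
structure IsAngulation [Preadditive C] [HasZeroObject C] [HasBinaryBiproducts C] (T : C ≌ C) (n : ℕ)
    (𝒩 : Set (AngleSeq T.functor n)) : Prop where
  iso_mem : ∀ X Y : AngleSeq T.functor n, X ∈ 𝒩 → Nonempty (X ≅ Y) → Y ∈ 𝒩
  /-- Closure under direct sums and direct summands. -/
  directSum_mem_iff : ∀ X Y Z : AngleSeq T.functor n, X.IsDirectSum Y Z →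
    (Z ∈ 𝒩 ↔ X ∈ 𝒩 ∧ Y ∈ 𝒩)
  /-- The trivial sequences `A = A ⟶ 0 ⟶ ⋯ ⟶ 0 ⟶ T A` are angles. -/
  trivial_mem : ∀ X : AngleSeq T.functor n, IsIso (X.seq.map' 0 1) →
    (∀ (i : ℕ) (_ : 2 ≤ i) (hi : i ≤ n + 1), IsZero (X.seq.obj' i)) → X ∈ 𝒩
  /-- Every morphism is the first morphism of an angle. -/
  exists_angle : ∀ {A B : C} (f : A ⟶ B),
    ∃ X ∈ 𝒩, Nonempty (Arrow.mk (X.seq.map' 0 1) ≅ Arrow.mk f)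
  rotation_mem_iff : ∀ X Y : AngleSeq T.functor n, Nonempty (X.LeftRotation Y) → (X ∈ 𝒩 ↔ Y ∈ 𝒩)
  /-- Every commutative square between the first morphisms of two angles can be completed to a
  morphism of angles whose mapping cone is an angle. -/
  exists_hom : ∀ X ∈ 𝒩, ∀ Y ∈ 𝒩, ∀ (a : X.seq.obj' 0 ⟶ Y.seq.obj' 0)
    (b : X.seq.obj' 1 ⟶ Y.seq.obj' 1), X.seq.map' 0 1 ≫ b = a ≫ Y.seq.map' 0 1 →
    ∃ φ : X ⟶ Y, AngleSeq.Hom.app φ 0 = a ∧ AngleSeq.Hom.app φ 1 = b ∧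
      ∃ Z ∈ 𝒩, Nonempty (AngleSeq.MappingCone φ Z)

/-- The terms `(X₀, …, Xₙ₊₁)` of the `(n + 2)`-angles. -/
def angleTerms {T : C ⥤ C} {n : ℕ} (𝒩 : Set (AngleSeq T n)) : Set (Fin (n + 2) → C) :=
  {X | ∃ A ∈ 𝒩, X = A.seq.obj}

/-- `S` is an `(n + 2)`-angulated subcategory: a full isomorphism-closed subcategory that is itself
`(n + 2)`-angulated, with respect to (the restriction of) `T`, such that the inclusion is an
`(n + 2)`-angulated functor, i.e. commutes with `T` and preserves `(n + 2)`-angles. -/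
def IsAngulatedSubcategory [Preadditive C] (T : C ≌ C) {n : ℕ} (𝒩 : Set (AngleSeq T.functor n))
    (S : ObjectProperty C) : Prop :=
  S.IsClosedUnderIsomorphisms ∧
  ∃ (_ : HasZeroObject S.FullSubcategory) (_ : HasBinaryBiproducts S.FullSubcategory)
    (T' : S.FullSubcategory ≌ S.FullSubcategory)
    (η : T'.functor ⋙ S.ι ≅ S.ι ⋙ T.functor) (𝒩' : Set (AngleSeq T'.functor n)),
    IsAngulation T' n 𝒩' ∧ ∀ X ∈ 𝒩', X.map S.ι η ∈ 𝒩

end Angulated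

/-! ## Exact categories -/

section Exact

variable {C : Type u} [Category.{v} C] [Preadditive C]

/-- Admissible monomorphisms (inflations) of a class of short complexes. -/
def IsAdmissibleMono (ℰ : Set (ShortComplex C)) {A B : C} (i : A ⟶ B) : Prop :=
  ∃ (D : C) (p : B ⟶ D) (h : i ≫ p = 0), ShortComplex.mk i p h ∈ ℰ

/-- Admissible epimorphisms (deflations) of a class of short complexes. -/
def IsAdmissibleEpi (ℰ : Set (ShortComplex C)) {B D : C} (p : B ⟶ D) : Prop :=
  ∃ (A : C) (i : A ⟶ B) (h : i ≫ p = 0), ShortComplex.mk i p h ∈ ℰ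

/-- `ℰ` is an exact structure in the sense of Quillen on the additive category `C`. -/
structure IsExactStructure (ℰ : Set (ShortComplex C)) : Prop where
  isKernel : ∀ S ∈ ℰ, Nonempty (IsLimit (KernelFork.ofι S.f S.zero))
  isCokernel : ∀ S ∈ ℰ, Nonempty (IsColimit (CokernelCofork.ofπ S.g S.zero))
  iso_mem : ∀ S S' : ShortComplex C, S ∈ ℰ → Nonempty (S ≅ S') → S' ∈ ℰ
  id_mono : ∀ A : C, IsAdmissibleMono ℰ (𝟙 A)
  id_epi : ∀ A : C, IsAdmissibleEpi ℰ (𝟙 A)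
  comp_mono : ∀ {A B D : C} (i : A ⟶ B) (j : B ⟶ D),
    IsAdmissibleMono ℰ i → IsAdmissibleMono ℰ j → IsAdmissibleMono ℰ (i ≫ j)
  comp_epi : ∀ {A B D : C} (p : A ⟶ B) (q : B ⟶ D),
    IsAdmissibleEpi ℰ p → IsAdmissibleEpi ℰ q → IsAdmissibleEpi ℰ (p ≫ q)
  exists_pushout : ∀ {A B A' : C} (i : A ⟶ B) (f : A ⟶ A'), IsAdmissibleMono ℰ i →
    ∃ (B' : C) (f' : B ⟶ B') (i' : A' ⟶ B'), IsPushout i f f' i' ∧ IsAdmissibleMono ℰ i'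
  exists_pullback : ∀ {B D D' : C} (p : B ⟶ D) (g : D' ⟶ D), IsAdmissibleEpi ℰ p →
    ∃ (B' : C) (g' : B' ⟶ B) (p' : B' ⟶ D'), IsPullback g' p' p g ∧ IsAdmissibleEpi ℰ p'

/-- The terms of the short exact sequences. -/
def exactTerms (ℰ : Set (ShortComplex C)) : Set (Fin (1 + 2) → C) :=
  {X | ∃ S ∈ ℰ, X = ![S.X₁, S.X₂, S.X₃]}

end Exact

/-! ## Extriangulated categories -/

section Extriangulated

variable {C : Type u} [Category.{v} C]

/-- The extensions `𝔼(D, A)`. -/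
abbrev Extension (𝔼 : Cᵒᵖ ⥤ C ⥤ AddCommGrpCat.{w}) (D A : C) : Type w :=
  (𝔼.obj (op D)).obj A

/-- `δ ↦ a_* δ`. -/
abbrev push (𝔼 : Cᵒᵖ ⥤ C ⥤ AddCommGrpCat.{w}) {D A A' : C} (a : A ⟶ A') :
    Extension 𝔼 D A →+ Extension 𝔼 D A' :=
  ((𝔼.obj (op D)).map a).hom

/-- `δ ↦ c^* δ`. -/
abbrev pull (𝔼 : Cᵒᵖ ⥤ C ⥤ AddCommGrpCat.{w}) {D D' A : C} (c : D' ⟶ D) :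
    Extension 𝔼 D A →+ Extension 𝔼 D' A :=
  ((𝔼.map c.op).app A).hom

variable (C) in
/-- An extriangulated structure in the sense of Nakaoka and Palu on the additive category `C`. -/
structure ExtriangulatedStructure [Preadditive C] [HasZeroObject C] [HasBinaryBiproducts C] where
  /-- The bifunctor `𝔼`. -/
  𝔼 : Cᵒᵖ ⥤ C ⥤ AddCommGrpCat.{w}
  /-- `Realizes δ x y` says that the equivalence class `𝔰(δ)` contains `A -x→ B -y→ D`. -/
  Realizes : ∀ {A D : C}, Extension 𝔼 D A → ∀ {B : C}, (A ⟶ B) → (B ⟶ D) → Prop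
  -- The bifunctor is biadditive.
  push_add : ∀ {D A A' : C} (a a' : A ⟶ A') (δ : Extension 𝔼 D A),
    push 𝔼 (a + a') δ = push 𝔼 a δ + push 𝔼 a' δ
  pull_add : ∀ {D D' A : C} (c c' : D' ⟶ D) (δ : Extension 𝔼 D A),
    pull 𝔼 (c + c') δ = pull 𝔼 c δ + pull 𝔼 c' δ
  -- `𝔰(δ)` is an equivalence class of sequences, for isomorphisms of the middle terms that are
  -- compatible with the identities of the end terms.
  exists_realizes : ∀ {A D : C} (δ : Extension 𝔼 D A),
    ∃ (B : C) (x : A ⟶ B) (y : B ⟶ D), Realizes δ x y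
  realizes_iff : ∀ {A D B B' : C} (δ : Extension 𝔼 D A) (x : A ⟶ B) (y : B ⟶ D) (x' : A ⟶ B')
    (y' : B' ⟶ D), Realizes δ x y →
    (Realizes δ x' y' ↔ ∃ b : B ≅ B', x ≫ b.hom = x' ∧ b.hom ≫ y' = y)
  -- `𝔰` is a realization: morphisms of extensions lift.
  exists_lift : ∀ {A B D A' B' D' : C} (δ : Extension 𝔼 D A) (δ' : Extension 𝔼 D' A')
    (x : A ⟶ B) (y : B ⟶ D) (x' : A' ⟶ B') (y' : B' ⟶ D') (a : A ⟶ A') (c : D ⟶ D'),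
    Realizes δ x y → Realizes δ' x' y' → push 𝔼 a δ = pull 𝔼 c δ' →
    ∃ b : B ⟶ B', x ≫ b = a ≫ x' ∧ y ≫ c = b ≫ y'
  -- The realization is additive.
  realizes_zero : ∀ A D : C, Realizes (0 : Extension 𝔼 D A) (biprod.inl : A ⟶ A ⊞ D) biprod.snd
  realizes_sum : ∀ {A B D A' B' D' : C} (δ : Extension 𝔼 D A) (δ' : Extension 𝔼 D' A')
    (x : A ⟶ B) (y : B ⟶ D) (x' : A' ⟶ B') (y' : B' ⟶ D'),
    Realizes δ x y → Realizes δ' x' y' →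
    Realizes (pull 𝔼 (biprod.fst : D ⊞ D' ⟶ D) (push 𝔼 (biprod.inl : A ⟶ A ⊞ A') δ) +
        pull 𝔼 (biprod.snd : D ⊞ D' ⟶ D') (push 𝔼 (biprod.inr : A' ⟶ A ⊞ A') δ'))
      (biprod.map x x') (biprod.map y y')
  /-- (ET3) -/
  et3 : ∀ {A B D A' B' D' : C} (δ : Extension 𝔼 D A) (δ' : Extension 𝔼 D' A')
    (x : A ⟶ B) (y : B ⟶ D) (x' : A' ⟶ B') (y' : B' ⟶ D') (a : A ⟶ A') (b : B ⟶ B'),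
    Realizes δ x y → Realizes δ' x' y' → x ≫ b = a ≫ x' →
    ∃ c : D ⟶ D', y ≫ c = b ≫ y' ∧ push 𝔼 a δ = pull 𝔼 c δ'
  /-- The dual of (ET3) -/
  et3_op : ∀ {A B D A' B' D' : C} (δ : Extension 𝔼 D A) (δ' : Extension 𝔼 D' A')
    (x : A ⟶ B) (y : B ⟶ D) (x' : A' ⟶ B') (y' : B' ⟶ D') (b : B ⟶ B') (c : D ⟶ D'),
    Realizes δ x y → Realizes δ' x' y' → y ≫ c = b ≫ y' →
    ∃ a : A ⟶ A', x ≫ b = a ≫ x' ∧ push 𝔼 a δ = pull 𝔼 c δ'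
  /-- (ET4) for `A -f→ B -f'→ D` and `B -g→ K -g'→ F` -/
  et4 : ∀ {A B D K F : C} (δ : Extension 𝔼 D A) (δ' : Extension 𝔼 F B)
    (f : A ⟶ B) (f' : B ⟶ D) (g : B ⟶ K) (g' : K ⟶ F),
    Realizes δ f f' → Realizes δ' g g' →
    ∃ (E : C) (h' : K ⟶ E) (d : D ⟶ E) (e : E ⟶ F) (δ'' : Extension 𝔼 E A),
      Realizes δ'' (f ≫ g) h' ∧ f' ≫ d = g ≫ h' ∧ h' ≫ e = g' ∧
      Realizes (push 𝔼 f' δ') d e ∧ pull 𝔼 d δ'' = δ ∧ push 𝔼 f δ'' = pull 𝔼 e δ'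
  /-- The dual of (ET4), for `D -f'→ A -f→ B` and `F -g'→ B -g→ K` -/
  et4_op : ∀ {A B D K F : C} (δ : Extension 𝔼 B D) (δ' : Extension 𝔼 K F)
    (f' : D ⟶ A) (f : A ⟶ B) (g' : F ⟶ B) (g : B ⟶ K),
    Realizes δ f' f → Realizes δ' g' g →
    ∃ (E : C) (d : D ⟶ E) (e : E ⟶ F) (h' : E ⟶ A) (δ'' : Extension 𝔼 K E),
      Realizes δ'' h' (f ≫ g) ∧ d ≫ h' = f' ∧ h' ≫ f = e ≫ g' ∧
      Realizes (pull 𝔼 g' δ) d e ∧ push 𝔼 e δ'' = δ' ∧ push 𝔼 d δ = pull 𝔼 g δ''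

/-- The terms of the conflations of an extriangulated category. -/
def extriangleTerms [Preadditive C] [HasZeroObject C] [HasBinaryBiproducts C]
    (𝒯 : ExtriangulatedStructure.{u, v, w} C) : Set (Fin (1 + 2) → C) :=
  {X | ∃ (A B D : C) (δ : Extension 𝒯.𝔼 D A) (x : A ⟶ B) (y : B ⟶ D),
    𝒯.Realizes δ x y ∧ X = ![A, B, D]}

end Extriangulated

/-! ## `n`-exact categories -/

section NExact

variable {C : Type u} [Category.{v} C] [Preadditive C] {n : ℕ}

/-- For `X₀ ⟶ X₁ ⟶ ⋯ ⟶ Xₙ₊₁`, the morphisms `(d₁, …, dₙ)` form an `n`-cokernel of `d₀`: for all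
`W` the sequence `0 ⟶ C(Xₙ₊₁, W) ⟶ C(Xₙ, W) ⟶ ⋯ ⟶ C(X₀, W)` is exact. -/
def IsNCokernel (X : ComposableArrows C (n + 1)) : Prop :=
  Epi (X.map' n (n + 1)) ∧
    ∀ (i : ℕ) (_ : i < n) (W : C) (g : X.obj' (i + 1) ⟶ W),
      X.map' i (i + 1) ≫ g = 0 ↔ ∃ h : X.obj' (i + 2) ⟶ W, X.map' (i + 1) (i + 2) ≫ h = g

/-- For `X₀ ⟶ X₁ ⟶ ⋯ ⟶ Xₙ₊₁`, the morphisms `(d₀, …, dₙ₋₁)` form an `n`-kernel of `dₙ`: for all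
`W` the sequence `0 ⟶ C(W, X₀) ⟶ C(W, X₁) ⟶ ⋯ ⟶ C(W, Xₙ₊₁)` is exact. -/
def IsNKernel (X : ComposableArrows C (n + 1)) : Prop :=
  Mono (X.map' 0 1) ∧
    ∀ (i : ℕ) (_ : i < n) (W : C) (g : W ⟶ X.obj' (i + 1)),
      g ≫ X.map' (i + 1) (i + 2) = 0 ↔ ∃ h : W ⟶ X.obj' i, h ≫ X.map' i (i + 1) = g

/-- `n`-exact sequences. -/
def IsNExactSeq (X : ComposableArrows C (n + 1)) : Prop :=
  IsNKernel X ∧ IsNCokernel X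

/-- A morphism `φ` of `n`-exact sequences is a weak isomorphism if `φₖ` and `φₖ₊₁` are isomorphisms
for some `k ∈ {0, …, n + 1}`, where `n + 2` is read as `0`. -/
def IsWeakIso {X Y : ComposableArrows C (n + 1)} (φ : X ⟶ Y) : Prop :=
  (∃ (k : ℕ) (_ : k ≤ n), IsIso (ComposableArrows.app' φ k) ∧
    IsIso (ComposableArrows.app' φ (k + 1))) ∨
  (IsIso (ComposableArrows.app' φ (n + 1)) ∧ IsIso (ComposableArrows.app' φ 0))

/-- `Z` is (isomorphic to) the mapping cone
`X₀ ⟶ X₁ ⊕ Y₀ ⟶ X₂ ⊕ Y₁ ⟶ ⋯ ⟶ Xₙ ⊕ Yₙ₋₁ ⟶ Yₙ` of the morphism `φ` from `X₀ ⟶ ⋯ ⟶ Xₙ` to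
`Y₀ ⟶ ⋯ ⟶ Yₙ`, with differentials `(x, y) ↦ (-d x, φ x + d y)`. -/
structure ArrowsCone [HasBinaryBiproducts C] {X Y : ComposableArrows C n} (φ : X ⟶ Y)
    (Z : ComposableArrows C (n + 1)) where
  /-- The projection of `Zᵢ` onto `Xᵢ`. -/
  p : ∀ (i : ℕ) (_ : i ≤ n), Z.obj' i ⟶ X.obj' i
  /-- The projection of `Zᵢ₊₁` onto `Yᵢ`. -/
  q : ∀ (i : ℕ) (_ : i ≤ n), Z.obj' (i + 1) ⟶ Y.obj' i
  isIso_p : IsIso (p 0 (by lia))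
  isIso_q : IsIso (q n le_rfl)
  isIso_lift : ∀ (i : ℕ) (hi : i < n), IsIso (biprod.lift (p (i + 1) (by lia)) (q i (by lia)))
  map_p : ∀ (i : ℕ) (hi : i < n), Z.map' i (i + 1) ≫ p (i + 1) (by lia) =
    -(p i (by lia) ≫ X.map' i (i + 1))
  map_q_zero : Z.map' 0 1 ≫ q 0 (by lia) = p 0 (by lia) ≫ ComposableArrows.app' φ 0
  map_q : ∀ (i : ℕ) (hi : i < n), Z.map' (i + 1) (i + 2) ≫ q (i + 1) (by lia) =
    p (i + 1) (by lia) ≫ ComposableArrows.app' φ (i + 1) + q i (by lia) ≫ Y.map' i (i + 1)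

/-- `φ : X ⟶ Y` is an `n`-pushout diagram of `X` along `φ₀`. -/
def IsNPushout [HasBinaryBiproducts C] {X Y : ComposableArrows C n} (φ : X ⟶ Y) : Prop :=
  ∃ Z : ComposableArrows C (n + 1), Nonempty (ArrowsCone φ Z) ∧ IsNCokernel Z

/-- `φ : Y ⟶ X` is an `n`-pullback diagram of `X` along `φₙ`. -/
def IsNPullback [HasBinaryBiproducts C] {Y X : ComposableArrows C n} (φ : Y ⟶ X) : Prop :=
  ∃ Z : ComposableArrows C (n + 1), Nonempty (ArrowsCone φ Z) ∧ IsNKernel Z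

/-- `f` is (isomorphic to) the first morphism of a sequence in `𝒳`. -/
def IsNAdmissibleMono (𝒳 : Set (ComposableArrows C (n + 1))) {A B : C} (f : A ⟶ B) : Prop :=
  ∃ X ∈ 𝒳, Nonempty (Arrow.mk (X.map' 0 1) ≅ Arrow.mk f)

/-- `f` is (isomorphic to) the last morphism of a sequence in `𝒳`. -/
def IsNAdmissibleEpi (𝒳 : Set (ComposableArrows C (n + 1))) {A B : C} (f : A ⟶ B) : Prop :=
  ∃ X ∈ 𝒳, Nonempty (Arrow.mk (X.map' n (n + 1)) ≅ Arrow.mk f)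

/-- `𝒳` is an `n`-exact structure in the sense of Jasso on the additive category `C`. For
`X = (X₀ ⟶ ⋯ ⟶ Xₙ₊₁)`, `X.δlast` is `X₀ ⟶ ⋯ ⟶ Xₙ` and `X.δ₀` is `X₁ ⟶ ⋯ ⟶ Xₙ₊₁`. -/
structure IsNExactStructure [HasBinaryBiproducts C]
    (𝒳 : Set (ComposableArrows C (n + 1))) : Prop where
  isNExactSeq : ∀ X ∈ 𝒳, IsNExactSeq X
  mem_iff_of_weakIso : ∀ (X Y : ComposableArrows C (n + 1)) (φ : X ⟶ Y),
    IsNExactSeq X → IsNExactSeq Y → IsWeakIso φ → (X ∈ 𝒳 ↔ Y ∈ 𝒳)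
  zero_mem : ∀ X : ComposableArrows C (n + 1), (∀ i, IsZero (X.obj i)) → X ∈ 𝒳
  comp_mono : ∀ {A B D : C} (i : A ⟶ B) (j : B ⟶ D),
    IsNAdmissibleMono 𝒳 i → IsNAdmissibleMono 𝒳 j → IsNAdmissibleMono 𝒳 (i ≫ j)
  comp_epi : ∀ {A B D : C} (p : A ⟶ B) (q : B ⟶ D),
    IsNAdmissibleEpi 𝒳 p → IsNAdmissibleEpi 𝒳 q → IsNAdmissibleEpi 𝒳 (p ≫ q)
  exists_pushout : ∀ X ∈ 𝒳, ∀ {A : C} (f : X.obj' 0 ⟶ A),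
    ∃ (Y : ComposableArrows C n) (φ : X.δlast ⟶ Y) (e : Y.obj' 0 ≅ A),
      ComposableArrows.app' φ 0 ≫ e.hom = f ∧ IsNPushout φ ∧
        ∀ _ : 0 < n, IsNAdmissibleMono 𝒳 (Y.map' 0 1)
  exists_pullback : ∀ X ∈ 𝒳, ∀ {A : C} (g : A ⟶ X.obj' (n + 1)),
    ∃ (Y : ComposableArrows C n) (φ : Y ⟶ X.δ₀) (e : A ≅ Y.obj' n),
      e.hom ≫ ComposableArrows.app' φ n = g ∧ IsNPullback φ ∧
        ∀ (k : ℕ) (_ : k + 1 = n), IsNAdmissibleEpi 𝒳 (Y.map' k n)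

/-- The terms of the admissible `n`-exact sequences. -/
def nExactTerms (𝒳 : Set (ComposableArrows C (n + 1))) : Set (Fin (n + 2) → C) :=
  {X | ∃ Y ∈ 𝒳, X = Y.obj}

end NExact

end GrothendieckClassification

end

open GrothendieckClassification

/-!
All five classifications are instances of one statement about a class `E` of families of objects
`(X₀, …, Xₙ₊₁)`, the terms of the conflations, with `n` odd. What is used about `E` is only that it
contains a family of zero objects, is closed under isomorphisms of the terms, and is closed under
adding a contractible family `(0, …, 0, W, W, 0, …, 0)`; such a class is an `IsConflationClass`.

The difficult half is that a dense subcategory `S` is recovered from the subgroup it generates: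
`[A] ∈ ⟨[B] | B ∈ S⟩` implies `A ∈ S`. The isomorphism classes of objects of `C` form a commutative
monoid `M` under `⊞`, and those of objects of `S` form a submonoid `P`. As `S` is closed at one end
of conflations, `P` is subtractive: `a + p ∈ P` and `p ∈ P` imply `a ∈ P`. By density each element
of `M` can be completed to one of `P`. Hence an element of `M` whose image in the Grothendieck
group of `M` is a difference of elements of `P` lies in `P`. So it suffices that the Euler relation
of each conflation is such a difference (`euler_mem_differences`). Adding contractible families
leaves the alternating sum unchanged, and density allows one to choose them one after the other so
that all terms except the last lie in `P`; then so does the last one. No exactness property of the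
conflations is needed. A subcategory closed at the first instead of the last term is treated by
reversing all conflations.

In the other direction, a generator or cogenerator `G` provides for each `A` some `A'` with
`[A] + [A'] ∈ ⟨G⟩`, because `n` is odd. Thus each element of `K₀` is `[A] + h` with `h ∈ ⟨G⟩`, and
the subcategory of a subgroup containing `⟨G⟩` is dense and generates that subgroup. The two halves
are combined in `isClassifiedBy_of`.

It remains to see that each type of category gives an `IsConflationClass`, that is, that conflations
are stable under direct sums with contractible ones. For exact and extriangulated categories this is
obtained from pushouts and pullbacks, respectively from additivity of the realization. For `n`-exact
structures with `n ≥ 2`, the inclusion into the direct sum with a contractible sequence is a weak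
isomorphism, while the case `n = 1` is reduced to exact structures. For `(n + 2)`-angulations all
contractible sequences are rotations of the trivial ones.

Finally, a dense complete subcategory of an `(n + 2)`-angulated category inherits the structure: to
find an angle with terms in `S` on a morphism of `S`, add contractible sequences to an angle in `C`
so that the terms `X₂, …, Xₙ` are moved into `S`, while the first morphism stays the same; the last
term then lies in `S` by completeness.
-/

noncomputable section

namespace GrothendieckClassification

/-! ### Families in a commutative monoid -/

section Monoid

open Algebra

variable {Q : Type*} [AddCommMonoid Q] {n : ℕ}

/-- The family `(w₀, w₀ + w₁, …, wₙ₋₁ + wₙ, wₙ)`: the classes of the terms of a direct sum of the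
contractible sequences `0 ⟶ ⋯ ⟶ Wᵢ = Wᵢ ⟶ ⋯ ⟶ 0`. Only `w₀, …, wₙ` matter. -/
def contractibleFamily (n : ℕ) (w : ℕ → Q) (j : Fin (n + 2)) : Q :=
  (if (j : ℕ) = 0 then 0 else w (j - 1)) + (if (j : ℕ) = n + 1 then 0 else w j)

/-- A set of families that contains `0` and is closed under adding one contractible family. -/
structure IsContractibleStable (F : Set (Fin (n + 2) → Q)) : Prop where
  zero_mem : 0 ∈ F
  add_single_mem : ∀ x ∈ F, ∀ (k : ℕ) (a : Q), k ≤ n →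
    x + contractibleFamily n (Pi.single k a) ∈ F

lemma contractibleFamily_add (w w' : ℕ → Q) :
    contractibleFamily n (w + w') = contractibleFamily n w + contractibleFamily n w' := by
  funext j
  simp only [contractibleFamily, Pi.add_apply]
  split_ifs <;> simp [add_add_add_comm]

lemma IsContractibleStable.add_mem {F : Set (Fin (n + 2) → Q)} (hF : IsContractibleStable F)
    {x : Fin (n + 2) → Q} (hx : x ∈ F) (w : ℕ → Q) : x + contractibleFamily n w ∈ F := by
  have key : ∀ k ≤ n + 1,
      x + contractibleFamily n (fun i => if i < k then w i else 0) ∈ F := by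
    intro k
    induction k with
    | zero =>
      intro _
      convert hx
      funext j
      simp [contractibleFamily]
    | succ k ih =>
      intro hk
      have h := hF.add_single_mem _ (ih (by lia)) k (w k) (by lia)
      rw [add_assoc, ← contractibleFamily_add] at h
      convert h using 4 with i
      by_cases hi : i = k
      · subst hi; simp
      · have : i < k + 1 ↔ i < k := by lia
        simp [hi, this]
  convert key (n + 1) le_rfl using 2
  funext j
  have := j.2
  simp only [contractibleFamily]
  congr 1
  · split_ifs <;> first | rfl | lia
  · split_ifs <;> first | rfl | lia

/-- The alternating sum of a contractible family telescopes. -/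
lemma sum_contractibleFamily {M : Type*} [AddCommGroup M] (φ : Q →+ M) (w : ℕ → Q) :
    ∑ j : Fin (n + 2), (-1 : ℤ) ^ (j : ℕ) • φ (contractibleFamily n w j) = 0 := by
  have h := Fin.sum_univ_eq_sum_range (fun j : ℕ => (-1 : ℤ) ^ j •
    (φ (if j = 0 then 0 else w (j - 1)) + φ (if j = n + 1 then 0 else w j))) (n + 2)
  simp only [contractibleFamily, map_add]
  rw [h]
  simp only [smul_add, Finset.sum_add_distrib]
  rw [Finset.sum_range_succ' _ (n + 1), Finset.sum_range_succ _ (n + 1)]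
  simp only [Nat.add_eq_zero_iff, one_ne_zero, and_false, if_false, if_true, map_zero, smul_zero,
    add_zero, Nat.add_sub_cancel]
  rw [← Finset.sum_add_distrib]
  refine Finset.sum_eq_zero fun j hj => ?_
  rw [if_neg (by have := Finset.mem_range.1 hj; lia), pow_succ]
  simp

/-- In a dense subset all terms but the last can be completed by a contractible family. -/
lemma exists_add_contractibleFamily_mem {P : Set Q} (hP : ∀ a, ∃ b, a + b ∈ P)
    (x : Fin (n + 2) → Q) :
    ∃ w : ℕ → Q, ∀ j, j ≠ Fin.last (n + 1) → x j + contractibleFamily n w j ∈ P := by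
  choose c hc using hP
  let x' : ℕ → Q := fun k => if h : k < n + 2 then x ⟨k, h⟩ else 0
  let w : ℕ → Q := fun k => Nat.rec (c (x' 0)) (fun k z => c (x' (k + 1) + z)) k
  refine ⟨w, fun j hj => ?_⟩
  obtain ⟨j, hj'⟩ := j
  have hj : j ≠ n + 1 := fun h => hj (Fin.ext h)
  rcases j with _ | j
  · convert hc (x' 0) using 1
    simp [contractibleFamily, x', w]
  · convert hc (x' (j + 1) + w j) using 1
    have hjn : j ≠ n := by lia
    have hx' : x' (j + 1) = x ⟨j + 1, hj'⟩ := dif_pos hj'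
    rw [hx', add_assoc (x _)]
    simp only [contractibleFamily]
    simp [hjn, ← hx', w]

/-- The subgroup of the Grothendieck group of `Q` of all differences of elements of `P`. -/
def differences (P : AddSubmonoid Q) : AddSubgroup (GrothendieckAddGroup Q) where
  carrier := {x | ∃ p ∈ P, ∃ q ∈ P, x = GrothendieckAddGroup.of p - GrothendieckAddGroup.of q}
  zero_mem' := ⟨0, P.zero_mem, 0, P.zero_mem, by simp⟩
  add_mem' := by
    rintro _ _ ⟨p, hp, q, hq, rfl⟩ ⟨p', hp', q', hq', rfl⟩
    exact ⟨p + p', P.add_mem hp hp', q + q', P.add_mem hq hq', by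
      rw [map_add, map_add]; abel⟩
  neg_mem' := by
    rintro _ ⟨p, hp, q, hq, rfl⟩
    exact ⟨q, hq, p, hp, by abel⟩

lemma of_mem_differences {P : AddSubmonoid Q} {p : Q} (hp : p ∈ P) :
    GrothendieckAddGroup.of p ∈ differences P :=
  ⟨p, hp, 0, P.zero_mem, by simp⟩

lemma mem_of_of_mem_differences {P : AddSubmonoid Q} (hP : ∀ a, ∃ b, a + b ∈ P)
    (hcancel : ∀ a p, p ∈ P → a + p ∈ P → a ∈ P) {a : Q}
    (ha : GrothendieckAddGroup.of a ∈ differences P) : a ∈ P := by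
  obtain ⟨p, hp, q, hq, h⟩ := ha
  rw [eq_sub_iff_add_eq, ← map_add] at h
  obtain ⟨c, hc⟩ := (AddLocalization.addMonoidOf (⊤ : AddSubmonoid Q)).eq_iff_exists.1 h
  obtain ⟨d, hd⟩ := hP (c : Q)
  refine hcancel a (q + (↑c + d)) (P.add_mem hq hd) ?_
  have e : a + (q + (↑c + d)) = p + (↑c + d) := by
    calc a + (q + (↑c + d)) = (↑c + (a + q)) + d := by abel
      _ = (↑c + p) + d := by rw [show (c : Q) + (a + q) = c + p from hc]
      _ = p + (↑c + d) := by abel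
  rw [e]
  exact P.add_mem hp hd

/-- If `P` is dense and closed under "last terms" of families in `F`, then the Euler relations of
the families in `F` hold in the Grothendieck group of `Q` modulo `P`. -/
lemma euler_mem_differences {F : Set (Fin (n + 2) → Q)} (hF : IsContractibleStable F)
    {P : AddSubmonoid Q} (hP : ∀ a, ∃ b, a + b ∈ P)
    (hlast : ∀ x ∈ F, (∀ j, j ≠ Fin.last (n + 1) → x j ∈ P) → x (Fin.last (n + 1)) ∈ P)
    {x : Fin (n + 2) → Q} (hx : x ∈ F) :
    ∑ j : Fin (n + 2), (-1 : ℤ) ^ (j : ℕ) • GrothendieckAddGroup.of (x j) ∈ differences P := by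
  obtain ⟨w, hw⟩ := exists_add_contractibleFamily_mem (P := (P : Set Q)) hP x
  have hall : ∀ j, x j + contractibleFamily n w j ∈ P := by
    intro j
    by_cases hj : j = Fin.last (n + 1)
    · subst hj
      exact hlast _ (hF.add_mem hx w) hw
    · exact hw j hj
  have h : ∑ j : Fin (n + 2), (-1 : ℤ) ^ (j : ℕ) • GrothendieckAddGroup.of (x j) =
      ∑ j : Fin (n + 2), (-1 : ℤ) ^ (j : ℕ) •
        GrothendieckAddGroup.of (x j + contractibleFamily n w j) := by
    simp only [map_add, smul_add, Finset.sum_add_distrib, sum_contractibleFamily, add_zero]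
  rw [h]
  exact sum_mem fun j _ => zsmul_mem (of_mem_differences (hall j)) _

lemma sum_rev {M : Type*} [AddCommGroup M] (hn : Odd n) (f : Fin (n + 2) → M) :
    ∑ j : Fin (n + 2), (-1 : ℤ) ^ (j : ℕ) • f j.rev =
      ∑ j : Fin (n + 2), (-1 : ℤ) ^ (j : ℕ) • f j := by
  rw [← Equiv.sum_comp Fin.revPerm (fun j : Fin (n + 2) => (-1 : ℤ) ^ (j : ℕ) • f j)]
  refine Finset.sum_congr rfl fun j _ => ?_
  have hj := j.2
  congr 1
  rw [Fin.revPerm_apply, Fin.val_rev]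
  obtain ⟨m, rfl⟩ := hn
  rcases Nat.even_or_odd (j : ℕ) with h | h
  · rw [h.neg_one_pow, Even.neg_one_pow]
    obtain ⟨k, hk⟩ := h
    exact ⟨m + 1 - k, by lia⟩
  · rw [h.neg_one_pow, Odd.neg_one_pow]
    obtain ⟨k, hk⟩ := h
    exact ⟨m - k, by lia⟩

end Monoid

/-! ### Classes of conflations in an additive category -/

section Conflations

open Algebra ZeroObject

variable {C : Type u} [Category.{v} C]

/-- The isomorphism class of an object. -/
def isoClass (A : C) : Quotient (isIsomorphicSetoid C) := Quotient.mk _ A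

lemma isoClass_eq_iff {A B : C} : isoClass A = isoClass B ↔ Nonempty (A ≅ B) :=
  Quotient.eq

variable [Preadditive C] [HasBinaryBiproducts C] {n : ℕ}

instance : Add (Quotient (isIsomorphicSetoid C)) where
  add := Quotient.map₂ (fun A B => A ⊞ B) fun _ _ ⟨e⟩ _ _ ⟨f⟩ => ⟨biprod.mapIso e f⟩

lemma isoClass_biprod (A B : C) : isoClass (A ⊞ B) = isoClass A + isoClass B := rfl

variable [HasZeroObject C]

instance : Zero (Quotient (isIsomorphicSetoid C)) where
  zero := isoClass 0

/-- The isomorphism classes of objects form a commutative monoid under direct sum. -/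
instance : AddCommMonoid (Quotient (isIsomorphicSetoid C)) where
  nsmul := nsmulRec
  add_assoc := by
    rintro ⟨A⟩ ⟨B⟩ ⟨D⟩
    exact Quotient.sound ⟨biprod.associator A B D⟩
  zero_add := by
    rintro ⟨A⟩
    exact Quotient.sound ⟨(isoZeroBiprod (isZero_zero C)).symm⟩
  add_zero := by
    rintro ⟨A⟩
    exact Quotient.sound ⟨(isoBiprodZero (isZero_zero C)).symm⟩
  add_comm := by
    rintro ⟨A⟩ ⟨B⟩
    exact Quotient.sound ⟨biprod.braiding A B⟩

omit [Preadditive C] [HasBinaryBiproducts C] in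
lemma isoClass_eq_zero_iff {A : C} : isoClass A = 0 ↔ IsZero A := by
  constructor
  · intro h
    obtain ⟨e⟩ := isoClass_eq_iff.1 (show isoClass A = isoClass (0 : C) from h)
    exact (isZero_zero C).of_iso e
  · intro h
    exact isoClass_eq_iff.2 ⟨h.iso (isZero_zero C)⟩

/-- The properties of the class of term families of conflations on which the classification rests:
it is closed under isomorphisms and under adding a contractible sequence
`0 ⟶ ⋯ ⟶ W = W ⟶ ⋯ ⟶ 0`, and it contains the zero families. -/
structure IsConflationClass (E : Set (Fin (n + 2) → C)) : Prop where
  zero_mem : ∃ X ∈ E, ∀ i, IsZero (X i)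
  iso_mem : ∀ X ∈ E, ∀ Y : Fin (n + 2) → C, (∀ i, Nonempty (X i ≅ Y i)) → Y ∈ E
  add_mem : ∀ X ∈ E, ∀ (W : C) (i : ℕ) (_ : i ≤ n), ∃ Y ∈ E,
    ∀ j : Fin (n + 2), Nonempty (Y j ≅ if (j : ℕ) = i ∨ (j : ℕ) = i + 1 then X j ⊞ W else X j)

/-- The families of isomorphism classes of the terms of conflations. -/
def isoClassFamilies (E : Set (Fin (n + 2) → C)) :
    Set (Fin (n + 2) → Quotient (isIsomorphicSetoid C)) :=
  {x | ∃ X ∈ E, ∀ j, isoClass (X j) = x j}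

namespace IsConflationClass

variable {E : Set (Fin (n + 2) → C)}

omit [HasZeroObject C] in
lemma mem_iff (hE : IsConflationClass E) {X : Fin (n + 2) → C} :
    X ∈ E ↔ (fun j => isoClass (X j)) ∈ isoClassFamilies E := by
  constructor
  · intro h
    exact ⟨X, h, fun _ => rfl⟩
  · rintro ⟨Y, hY, h⟩
    exact hE.iso_mem Y hY X fun i => isoClass_eq_iff.1 (h i)

lemma isContractibleStable (hE : IsConflationClass E) :
    IsContractibleStable (isoClassFamilies E) where
  zero_mem := by
    obtain ⟨X, hX, h⟩ := hE.zero_mem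
    exact ⟨X, hX, fun j => isoClass_eq_zero_iff.2 (h j)⟩
  add_single_mem := by
    rintro x ⟨X, hX, h⟩ k ⟨W⟩ hk
    obtain ⟨Y, hY, e⟩ := hE.add_mem X hX W k hk
    refine ⟨Y, hY, fun j => ?_⟩
    rw [isoClass_eq_iff.2 (e j)]
    have hj := j.2
    change _ = x j + contractibleFamily n (Pi.single k (isoClass W)) j
    simp only [contractibleFamily, Pi.single_apply, ← h j]
    by_cases h1 : (j : ℕ) = k
    · rw [if_pos (Or.inl h1), isoClass_biprod, if_neg (show ¬ (j : ℕ) = n + 1 by lia), if_pos h1]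
      congr 1
      split_ifs
      · simp
      · lia
      · simp
    · by_cases h2 : (j : ℕ) = k + 1
      · rw [if_pos (Or.inr h2), isoClass_biprod, if_neg h1, if_neg (show ¬ (j : ℕ) = 0 by lia),
          if_pos (by lia), ite_self, add_zero]
      · rw [if_neg (by lia), if_neg h1, ite_self, add_zero]
        split_ifs
        · simp
        · lia
        · simp

lemma contractibleFamily_mem (hE : IsConflationClass E)
    (w : ℕ → Quotient (isIsomorphicSetoid C)) :
    contractibleFamily n w ∈ isoClassFamilies E := by
  simpa using hE.isContractibleStable.add_mem hE.isContractibleStable.zero_mem w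

/-- The terms of `A ⟶ A ⊞ B ⟶ B ⟶ 0 ⟶ ⋯ ⟶ 0`, a sum of two contractible sequences, are those of a
conflation. -/
lemma split_mem (hE : IsConflationClass E) (hn : 0 < n) {A B Z : C} (e : Nonempty (Z ≅ A ⊞ B)) :
    (fun j : Fin (n + 2) => if (j : ℕ) = 0 then A else if (j : ℕ) = 1 then Z else
      if (j : ℕ) = 2 then B else 0) ∈ E := by
  rw [hE.mem_iff]
  convert hE.contractibleFamily_mem (fun i => if i = 0 then isoClass A else if i = 1 then
    isoClass B else 0) using 1
  funext j
  have hj := j.2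
  obtain ⟨j, hj'⟩ := j
  simp only [contractibleFamily]
  rcases j with _ | _ | _ | j
  · simp
  · have : ¬ (n = 0) := by lia
    simp [this, isoClass_eq_iff.2 e, isoClass_biprod]
  · simp
  · simp [isoClass_eq_zero_iff, isZero_zero]

/-- The class of conflations read backwards. As only the terms count, this interchanges the two
ends of a conflation without passing to the opposite category. -/
def _root_.GrothendieckClassification.reverse (E : Set (Fin (n + 2) → C)) :
    Set (Fin (n + 2) → C) :=
  {X | (fun j => X j.rev) ∈ E}

omit [HasZeroObject C] in
lemma reverse (hE : IsConflationClass E) : IsConflationClass (reverse E) where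
  zero_mem := by
    obtain ⟨X, hX, h⟩ := hE.zero_mem
    exact ⟨fun j => X j.rev, by simpa [GrothendieckClassification.reverse] using hX, fun i => h _⟩
  iso_mem X hX Y e := hE.iso_mem _ hX _ fun i => e _
  add_mem X hX W i hi := by
    obtain ⟨Y, hY, e⟩ := hE.add_mem _ hX W (n - i) (by lia)
    refine ⟨fun j => Y j.rev, by simpa [GrothendieckClassification.reverse] using hY, fun j => ?_⟩
    convert e j.rev using 3
    · rw [Fin.val_rev]
      have hj := j.2
      lia
    · rw [Fin.rev_rev]
    · rw [Fin.rev_rev]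

end IsConflationClass

/-! ### The Grothendieck group of a class of conflations -/

/-- The class in `K₀` of an isomorphism class of objects. -/
def K0.ofIsoClass (E : Set (Fin (n + 2) → C)) (a : Quotient (isIsomorphicSetoid C)) : K0 E :=
  QuotientAddGroup.mk (FreeAbelianGroup.of a)

omit [Preadditive C] [HasBinaryBiproducts C] [HasZeroObject C] in
lemma K0.ofIsoClass_isoClass (E : Set (Fin (n + 2) → C)) (A : C) :
    K0.ofIsoClass E (isoClass A) = K0.cls E A := rfl

variable {E : Set (Fin (n + 2) → C)}

omit [Preadditive C] [HasBinaryBiproducts C] [HasZeroObject C] in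
lemma K0.sum_ofIsoClass {x : Fin (n + 2) → Quotient (isIsomorphicSetoid C)}
    (hx : x ∈ isoClassFamilies E) :
    ∑ j : Fin (n + 2), (-1 : ℤ) ^ (j : ℕ) • K0.ofIsoClass E (x j) = 0 := by
  obtain ⟨X, hX, h⟩ := hx
  have hmem : eulerRelation X ∈ eulerSubgroup E :=
    AddSubgroup.subset_closure (Set.mem_image_of_mem _ hX)
  have := (QuotientAddGroup.eq_zero_iff _).2 hmem
  rw [← this]
  simp only [← h, K0.ofIsoClass, eulerRelation]
  exact (map_sum (QuotientAddGroup.mk' (eulerSubgroup E)) _ _).symm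

omit [Preadditive C] [HasBinaryBiproducts C] [HasZeroObject C] in
lemma K0.sum_cls {X : Fin (n + 2) → C} (hX : X ∈ E) :
    ∑ j : Fin (n + 2), (-1 : ℤ) ^ (j : ℕ) • K0.cls E (X j) = 0 :=
  K0.sum_ofIsoClass ⟨X, hX, fun _ => rfl⟩

omit [Preadditive C] [HasBinaryBiproducts C] [HasZeroObject C] in
lemma K0.cls_eq_of_iso {A B : C} (e : Nonempty (A ≅ B)) : K0.cls E A = K0.cls E B := by
  rw [← K0.ofIsoClass_isoClass, isoClass_eq_iff.2 e, K0.ofIsoClass_isoClass]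

lemma sum_neg_one_pow_of_odd {M : Type*} [AddCommGroup M] (hn : Odd n) (m : M) :
    ∑ j : Fin (n + 2), (-1 : ℤ) ^ (j : ℕ) • m = m := by
  rw [← Finset.sum_smul, Fin.sum_univ_eq_sum_range (fun j : ℕ => (-1 : ℤ) ^ j), neg_one_geom_sum,
    if_neg (by rw [Nat.not_even_iff_odd]; exact hn.add_even even_two), one_smul]

lemma K0.ofIsoClass_zero (hE : IsConflationClass E) (hn : Odd n) :
    K0.ofIsoClass E (0 : Quotient (isIsomorphicSetoid C)) = 0 := by
  rw [← sum_neg_one_pow_of_odd hn (K0.ofIsoClass E 0)]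
  exact K0.sum_ofIsoClass hE.isContractibleStable.zero_mem

lemma K0.cls_eq_zero (hE : IsConflationClass E) (hn : Odd n) {A : C} (hA : IsZero A) :
    K0.cls E A = 0 := by
  rw [← K0.ofIsoClass_isoClass, isoClass_eq_zero_iff.2 hA, K0.ofIsoClass_zero hE hn]

lemma K0.cls_biprod (hE : IsConflationClass E) (hn : Odd n) (A B : C) :
    K0.cls E (A ⊞ B) = K0.cls E A + K0.cls E B := by
  have h := K0.sum_cls (hE.split_mem hn.pos ⟨Iso.refl (A ⊞ B)⟩)
  obtain ⟨m, rfl⟩ : ∃ m, n = m + 1 := ⟨n - 1, by have := hn.pos; lia⟩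
  rw [Fin.sum_univ_succ, Fin.sum_univ_succ, Fin.sum_univ_succ, Finset.sum_eq_zero] at h
  · simp only [Fin.val_succ, Fin.val_zero] at h
    norm_num at h
    rw [← sub_eq_zero, ← neg_eq_zero, ← h]
    abel
  · intro j _
    simp [K0.cls_eq_zero hE hn (isZero_zero C)]

omit [Preadditive C] [HasBinaryBiproducts C] [HasZeroObject C] in
lemma eulerSubgroup_le_iff {L : AddSubgroup (FreeAbelianGroup (Quotient (isIsomorphicSetoid C)))} :
    eulerSubgroup E ≤ L ↔ ∀ X ∈ E, eulerRelation X ∈ L := by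
  rw [eulerSubgroup, AddSubgroup.closure_le, Set.image_subset_iff]
  rfl

end Conflations

/-! ### Dense subcategories and subgroups of the Grothendieck group -/

section Classification

open Algebra ZeroObject

variable {C : Type u} [Category.{v} C] {n : ℕ} {E : Set (Fin (n + 2) → C)} {S : ObjectProperty C}

/-- The term number `k` of a conflation lies in `S` as soon as all the other ones do. -/
def IsClosedAt (E : Set (Fin (n + 2) → C)) (S : ObjectProperty C) (k : Fin (n + 2)) : Prop :=
  ∀ X ∈ E, (∀ i, i ≠ k → S (X i)) → S (X k)

lemma IsClosedAt.reverse (hS : IsClosedAt E S 0) :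
    IsClosedAt (reverse E) S (Fin.last (n + 1)) := by
  intro X hX h
  have := hS _ hX fun i hi => h _ (by simpa [Fin.rev_eq_iff] using hi)
  simpa using this

variable [Preadditive C] [HasBinaryBiproducts C] [HasZeroObject C]

lemma IsDenseSubcategory.exists_prop (hd : IsDenseSubcategory S) : ∃ A, S A := by
  obtain ⟨_, B, hB, _⟩ := hd 0
  exact ⟨B, hB⟩

lemma IsClosedAt.prop_of_isZero (hS : IsClosedAt E S (Fin.last (n + 1)))
    (hE : IsConflationClass E) (hn : Odd n) (hd : IsDenseSubcategory S) {Z : C} (hZ : IsZero Z) :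
    S Z := by
  obtain ⟨A, hA⟩ := hd.exists_prop
  -- the conflation `A ⟶ A ⟶ ⋯ ⟶ A ⟶ Z` with an even number of terms `A`
  have h : (fun j : Fin (n + 2) => if j = Fin.last (n + 1) then Z else A) ∈ E := by
    rw [hE.mem_iff]
    convert hE.contractibleFamily_mem (fun i => if Even i then isoClass A else 0) using 1
    funext j
    have hj := j.2
    have hn' : ¬ Even n := by simpa using hn
    simp only [contractibleFamily, Fin.ext_iff, Fin.val_last]
    by_cases h1 : (j : ℕ) = n + 1
    · simp [h1, hn', isoClass_eq_zero_iff.2 hZ]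
    · by_cases h0 : (j : ℕ) = 0
      · simp [h0]
      · rw [if_neg h1, if_neg h1, if_neg h0]
        rcases Nat.even_or_odd (j : ℕ) with h | h
        · have h' : ¬ Even ((j : ℕ) - 1) := by grind
          rw [if_pos h, if_neg h', zero_add]
        · have h' : ¬ Even (j : ℕ) := by simpa using h
          have h'' : Even ((j : ℕ) - 1) := by grind
          rw [if_neg h', if_pos h'', add_zero]
  have := hS _ h fun i hi => by simpa [hi] using hA
  simpa using this

/-- Closure at the last term applies to the split sequence `0 ⟶ ⋯ ⟶ 0 ⟶ B ⟶ A ⊞ B ⟶ A`. -/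
lemma IsClosedAt.prop_of_biprod (hS : IsClosedAt E S (Fin.last (n + 1)))
    (hE : IsConflationClass E) (hn : Odd n) (hd : IsDenseSubcategory S) {A B Z : C} (hB : S B)
    (hZ : S Z) (e : Nonempty (Z ≅ A ⊞ B)) : S A := by
  have h := hE.reverse.split_mem hn.pos e
  have := hS _ h fun i hi => by
    have hi' : ¬ ((i.rev : Fin (n + 2)) : ℕ) = 0 := by
      intro h0
      exact hi (by rw [← Fin.rev_rev i, show i.rev = 0 from Fin.ext h0]; rfl)
    simp only [hi', if_false]
    split_ifs
    · exact hZ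
    · exact hB
    · exact hS.prop_of_isZero hE hn hd (isZero_zero C)
  simpa using this

lemma IsClosedAt.isClosedUnderIsomorphisms (hS : IsClosedAt E S (Fin.last (n + 1)))
    (hE : IsConflationClass E) (hn : Odd n) (hd : IsDenseSubcategory S) :
    S.IsClosedUnderIsomorphisms where
  of_iso e hA := hS.prop_of_biprod hE hn hd (hS.prop_of_isZero hE hn hd (isZero_zero C)) hA
    ⟨e ≪≫ isoBiprodZero (isZero_zero C)⟩

/-- The data extracted from `S` for the algebraic part of the argument: the isomorphism classes of
objects of `S` form a dense submonoid, modulo which the Euler relations hold. -/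
structure IsEulerSubmonoid (E : Set (Fin (n + 2) → C)) (S : ObjectProperty C)
    (P : AddSubmonoid (Quotient (isIsomorphicSetoid C))) : Prop where
  mem_iff : ∀ A, isoClass A ∈ P ↔ S A
  exists_add_mem : ∀ a, ∃ b, a + b ∈ P
  mem_of_add_mem : ∀ a p, p ∈ P → a + p ∈ P → a ∈ P
  euler : ∀ X ∈ E, ∑ j : Fin (n + 2),
    (-1 : ℤ) ^ (j : ℕ) • GrothendieckAddGroup.of (isoClass (X j)) ∈ differences P

lemma IsClosedAt.exists_isEulerSubmonoid (hS : IsClosedAt E S (Fin.last (n + 1)))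
    (hE : IsConflationClass E) (hn : Odd n) (hd : IsDenseSubcategory S)
    (hsum : ∀ A B Z, S A → S B → Nonempty (Z ≅ A ⊞ B) → S Z) :
    ∃ P, IsEulerSubmonoid E S P := by
  have hiso := hS.isClosedUnderIsomorphisms hE hn hd
  let P : AddSubmonoid (Quotient (isIsomorphicSetoid C)) :=
    { carrier := {a | ∃ A, S A ∧ isoClass A = a}
      zero_mem' := ⟨0, hS.prop_of_isZero hE hn hd (isZero_zero C), rfl⟩
      add_mem' := by
        rintro _ _ ⟨A, hA, rfl⟩ ⟨B, hB, rfl⟩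
        exact ⟨A ⊞ B, hsum A B _ hA hB ⟨Iso.refl _⟩, rfl⟩ }
  have hP : ∀ A, isoClass A ∈ P ↔ S A := by
    intro A
    constructor
    · rintro ⟨B, hB, h⟩
      obtain ⟨e⟩ := isoClass_eq_iff.1 h
      exact S.prop_of_iso e hB
    · intro hA
      exact ⟨A, hA, rfl⟩
  have hdense : ∀ a, ∃ b, a + b ∈ P := by
    rintro ⟨A⟩
    obtain ⟨A', B, hB, e⟩ := hd A
    exact ⟨isoClass A', B, hB, isoClass_eq_iff.2 e⟩
  refine ⟨P, hP, hdense, ?_, fun X hX => ?_⟩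
  · rintro ⟨A⟩ _ ⟨B, hB, rfl⟩ ⟨Z, hZ, h⟩
    exact (hP A).2 (hS.prop_of_biprod hE hn hd hB hZ (isoClass_eq_iff.1 h))
  · refine euler_mem_differences hE.isContractibleStable hdense ?_ (hE.mem_iff.1 hX)
    rintro x ⟨Y, hY, h⟩ hx
    simp only [← h, hP] at hx ⊢
    exact hS Y hY hx

lemma IsEulerSubmonoid.of_reverse {P : AddSubmonoid (Quotient (isIsomorphicSetoid C))}
    (hP : IsEulerSubmonoid (reverse E) S P) (hn : Odd n) : IsEulerSubmonoid E S P where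
  mem_iff := hP.mem_iff
  exists_add_mem := hP.exists_add_mem
  mem_of_add_mem := hP.mem_of_add_mem
  euler X hX := by
    have := hP.euler (fun j => X j.rev) (by simpa [reverse] using hX)
    rwa [sum_rev hn (fun j => GrothendieckAddGroup.of (isoClass (X j)))] at this

/-- An object of `C` lies in a dense subcategory `S` if its class is a combination of classes of
objects of `S`: this inclusion is the heart of the classification. -/
lemma IsEulerSubmonoid.subcategoryOf_subgroupOf
    {P : AddSubmonoid (Quotient (isIsomorphicSetoid C))} (hP : IsEulerSubmonoid E S P) :
    subcategoryOf (subgroupOf E S) = S := by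
  funext A
  refine propext ⟨fun hA => ?_, fun hA => AddSubgroup.subset_closure ⟨A, hA, rfl⟩⟩
  let φ : FreeAbelianGroup (Quotient (isIsomorphicSetoid C)) →+
      GrothendieckAddGroup (Quotient (isIsomorphicSetoid C)) :=
    FreeAbelianGroup.lift fun a => GrothendieckAddGroup.of a
  let L := (differences P).comap φ
  have hL : eulerSubgroup E ≤ L := by
    rw [eulerSubgroup_le_iff]
    intro X hX
    change φ (eulerRelation X) ∈ differences P
    rw [eulerRelation, map_sum]
    simp only [map_zsmul, φ, FreeAbelianGroup.lift_apply_of]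
    exact hP.euler X hX
  have hle : subgroupOf E S ≤ L.map (QuotientAddGroup.mk' (eulerSubgroup E)) := by
    rw [subgroupOf, AddSubgroup.closure_le]
    rintro _ ⟨B, hB, rfl⟩
    refine ⟨FreeAbelianGroup.of (isoClass B), ?_, rfl⟩
    change φ _ ∈ differences P
    rw [FreeAbelianGroup.lift_apply_of]
    exact of_mem_differences ((hP.mem_iff B).2 hB)
  obtain ⟨y, hy, h⟩ := hle hA
  have hsub : -y + FreeAbelianGroup.of (isoClass A) ∈ L := hL (QuotientAddGroup.eq.1 h)
  have hAL : φ (FreeAbelianGroup.of (isoClass A)) ∈ differences P := by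
    have := L.add_mem hy hsub
    rwa [add_neg_cancel_left] at this
  rw [FreeAbelianGroup.lift_apply_of] at hAL
  exact (hP.mem_iff A).1 (mem_of_of_mem_differences hP.exists_add_mem hP.mem_of_add_mem hAL)

omit [Preadditive C] [HasBinaryBiproducts C] [HasZeroObject C] in
lemma subgroupOf_mono {G S : ObjectProperty C} (h : G ≤ S) : subgroupOf E G ≤ subgroupOf E S :=
  AddSubgroup.closure_mono fun _ ⟨A, hA, e⟩ => ⟨A, h A hA, e⟩

omit [Preadditive C] [HasBinaryBiproducts C] [HasZeroObject C] in
lemma subgroupOf_le_iff {G : ObjectProperty C} {H : AddSubgroup (K0 E)} :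
    subgroupOf E G ≤ H ↔ G ≤ subcategoryOf H := by
  rw [subgroupOf, AddSubgroup.closure_le]
  constructor
  · exact fun h A hA => h ⟨A, hA, rfl⟩
  · rintro h _ ⟨A, hA, rfl⟩
    exact h A hA

omit [Preadditive C] [HasBinaryBiproducts C] [HasZeroObject C] in
lemma isCompleteSubcategory_subcategoryOf (H : AddSubgroup (K0 E)) :
    IsCompleteSubcategory E (subcategoryOf H) := by
  intro X hX j h
  have hsum := K0.sum_cls hX
  rw [← Finset.add_sum_erase _ _ (Finset.mem_univ j), add_eq_zero_iff_eq_neg] at hsum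
  have hj : (-1 : ℤ) ^ (j : ℕ) • K0.cls E (X j) ∈ H := by
    rw [hsum]
    exact H.neg_mem (sum_mem fun i hi => H.zsmul_mem (h i (Finset.ne_of_mem_erase hi)) _)
  have := H.zsmul_mem hj ((-1 : ℤ) ^ (j : ℕ))
  rwa [smul_smul, ← pow_add, Even.neg_one_pow ⟨_, rfl⟩, one_smul] at this

omit [Preadditive C] [HasBinaryBiproducts C] [HasZeroObject C] in
lemma exists_cls_add_cls_mem (hn : Odd n) {G : ObjectProperty C}
    (hG : IsNGenerator E G ∨ IsNCogenerator E G) (A : C) :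
    ∃ A', K0.cls E A + K0.cls E A' ∈ subgroupOf E G := by
  have key : ∀ X ∈ E, (∀ i, i ≠ 0 → i ≠ Fin.last (n + 1) → G (X i)) →
      K0.cls E (X 0) + K0.cls E (X (Fin.last (n + 1))) ∈ subgroupOf E G := by
    intro X hX h
    have hsum := K0.sum_cls hX
    rw [Fin.sum_univ_succ, Fin.sum_univ_castSucc] at hsum
    have hodd : Even (((Fin.last n).succ : Fin (n + 2)) : ℕ) := by
      simpa using hn.add_one
    rw [hodd.neg_one_pow, Fin.val_zero, pow_zero, one_smul, one_smul, ← add_assoc,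
      add_right_comm, add_eq_zero_iff_eq_neg, Fin.succ_last] at hsum
    rw [hsum]
    refine neg_mem (sum_mem fun i _ => zsmul_mem ?_ _)
    refine AddSubgroup.subset_closure ⟨_, h i.castSucc.succ ?_ ?_, rfl⟩
    · exact Fin.succ_ne_zero _
    · intro he
      have := congrArg Fin.val he
      have hi := i.2
      simp at this
      lia
  rcases hG with hG | hG
  · obtain ⟨X, hX, e, h⟩ := hG A
    refine ⟨X 0, ?_⟩
    rw [← K0.cls_eq_of_iso e, add_comm]
    exact key X hX h
  · obtain ⟨X, hX, e, h⟩ := hG A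
    refine ⟨X (Fin.last _), ?_⟩
    rw [← K0.cls_eq_of_iso e]
    exact key X hX h

lemma isDenseSubcategory_subcategoryOf (hE : IsConflationClass E) (hn : Odd n)
    {G : ObjectProperty C} (hG : IsNGenerator E G ∨ IsNCogenerator E G) {H : AddSubgroup (K0 E)}
    (hH : subgroupOf E G ≤ H) : IsDenseSubcategory (subcategoryOf H) := by
  intro A
  obtain ⟨A', h⟩ := exists_cls_add_cls_mem hn hG A
  refine ⟨A', A ⊞ A', ?_, ⟨Iso.refl _⟩⟩
  change K0.cls E (A ⊞ A') ∈ H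
  rw [K0.cls_biprod hE hn]
  exact hH h

/-- Modulo the image of a generator every element of `K₀` is the class of an object. -/
lemma exists_eq_cls_add (hE : IsConflationClass E) (hn : Odd n) {G : ObjectProperty C}
    (hG : IsNGenerator E G ∨ IsNCogenerator E G) (x : K0 E) :
    ∃ A, ∃ h ∈ subgroupOf E G, x = K0.cls E A + h := by
  obtain ⟨y, rfl⟩ := QuotientAddGroup.mk_surjective x
  induction y using FreeAbelianGroup.induction_on with
  | zero => exact ⟨0, 0, zero_mem _, by rw [K0.cls_eq_zero hE hn (isZero_zero C)]; simp⟩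
  | of a =>
    obtain ⟨A, rfl⟩ := Quotient.exists_rep a
    exact ⟨A, 0, zero_mem _, by rw [add_zero]; rfl⟩
  | neg a _ =>
    obtain ⟨A, rfl⟩ := Quotient.exists_rep a
    obtain ⟨A', hA'⟩ := exists_cls_add_cls_mem hn hG A
    refine ⟨A', _, neg_mem hA', ?_⟩
    rw [QuotientAddGroup.mk_neg]
    change -K0.cls E A = _
    abel
  | add a b ha hb =>
    obtain ⟨A, h, hh, ha⟩ := ha
    obtain ⟨B, h', hh', hb⟩ := hb
    refine ⟨A ⊞ B, h + h', add_mem hh hh', ?_⟩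
    rw [QuotientAddGroup.mk_add, ha, hb, K0.cls_biprod hE hn]
    abel

lemma subgroupOf_subcategoryOf (hE : IsConflationClass E) (hn : Odd n) {G : ObjectProperty C}
    (hG : IsNGenerator E G ∨ IsNCogenerator E G) {H : AddSubgroup (K0 E)}
    (hH : subgroupOf E G ≤ H) : subgroupOf E (subcategoryOf H) = H := by
  refine le_antisymm (subgroupOf_le_iff.2 le_rfl) fun x hx => ?_
  obtain ⟨A, h, hh, rfl⟩ := exists_eq_cls_add hE hn hG x
  refine add_mem (AddSubgroup.subset_closure ⟨A, ?_, rfl⟩)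
    (subgroupOf_mono (subgroupOf_le_iff.1 hH) hh)
  have := sub_mem hx (hH hh)
  rwa [add_sub_cancel_right] at this

/-- The common form of all the classifications: it suffices that subcategories of subgroups belong
to `𝒮` and that the members of `𝒮` are dense, contain the (co)generator, and are closed under
direct sums and at one of the two ends of conflations. -/
theorem isClassifiedBy_of (hE : IsConflationClass E) (hn : Odd n) {G : ObjectProperty C}
    (hG : IsNGenerator E G ∨ IsNCogenerator E G) {𝒮 : Set (ObjectProperty C)}
    (hf : ∀ H : AddSubgroup (K0 E), G ≤ subcategoryOf H → IsDenseSubcategory (subcategoryOf H) →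
      IsCompleteSubcategory E (subcategoryOf H) → subcategoryOf H ∈ 𝒮)
    (hg : ∀ S ∈ 𝒮, IsDenseSubcategory S ∧ G ≤ S ∧
      (∀ A B Z, S A → S B → Nonempty (Z ≅ A ⊞ B) → S Z) ∧
      (IsClosedAt E S 0 ∨ IsClosedAt E S (Fin.last (n + 1)))) :
    IsClassifiedBy E 𝒮 (subgroupOf E G) := by
  refine ⟨fun H hH => ?_, fun S hS => subgroupOf_mono (hg S hS).2.1, fun H hH => ?_,
    fun S hS => ?_⟩
  · exact hf H (subgroupOf_le_iff.1 hH) (isDenseSubcategory_subcategoryOf hE hn hG hH)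
      (isCompleteSubcategory_subcategoryOf H)
  · exact subgroupOf_subcategoryOf hE hn hG hH
  · obtain ⟨hd, -, hsum, h | h⟩ := hg S hS
    · obtain ⟨P, hP⟩ := h.reverse.exists_isEulerSubmonoid hE.reverse hn hd hsum
      exact (hP.of_reverse hn).subcategoryOf_subgroupOf
    · obtain ⟨P, hP⟩ := h.exists_isEulerSubmonoid hE hn hd hsum
      exact hP.subcategoryOf_subgroupOf

omit [Preadditive C] [HasBinaryBiproducts C] [HasZeroObject C] in
lemma IsCompleteSubcategory.isClosedAt (hS : IsCompleteSubcategory E S) (k : Fin (n + 2)) :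
    IsClosedAt E S k :=
  fun X hX h => hS X hX k h

lemma IsCompleteSubcategory.prop_of_biprod_iso (hS : IsCompleteSubcategory E S)
    (hE : IsConflationClass E) (hn : Odd n) (hd : IsDenseSubcategory S) (A B Z : C) (hA : S A)
    (hB : S B) (e : Nonempty (Z ≅ A ⊞ B)) : S Z := by
  have := hS _ (hE.split_mem hn.pos e) 1 fun i hi => by
    have hi' : ¬ (i : ℕ) = 1 := fun h => hi (Fin.ext (by simpa using h))
    simp only [hi', if_false]
    split_ifs
    · exact hA
    · exact hB
    · exact (hS.isClosedAt _).prop_of_isZero hE hn hd (isZero_zero C)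
  simpa using this

theorem isClassifiedBy_complete (hE : IsConflationClass E) (hn : Odd n) {G : ObjectProperty C}
    (hG : IsNGenerator E G ∨ IsNCogenerator E G) :
    IsClassifiedBy E {S | IsDenseSubcategory S ∧ IsCompleteSubcategory E S ∧ G ≤ S}
      (subgroupOf E G) :=
  isClassifiedBy_of hE hn hG (fun _ hH hd hc => ⟨hd, hc, hH⟩) fun _ ⟨hd, hc, hGS⟩ =>
    ⟨hd, hGS, hc.prop_of_biprod_iso hE hn hd, Or.inl (hc.isClosedAt 0)⟩

lemma IsConflationClass.vec_split_mem {E : Set (Fin (1 + 2) → C)} (hE : IsConflationClass E)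
    {A B Z : C} (e : Nonempty (Z ≅ A ⊞ B)) : ![A, Z, B] ∈ E := by
  convert hE.split_mem one_pos e using 1
  funext j
  fin_cases j <;> rfl

theorem isClassifiedBy_resolving {E : Set (Fin (1 + 2) → C)} (hE : IsConflationClass E)
    {G : ObjectProperty C} (hG : IsNGenerator E G) :
    IsClassifiedBy E {S | IsDenseSubcategory S ∧ IsResolving E G S} (subgroupOf E G) := by
  refine isClassifiedBy_of hE odd_one (Or.inl hG) (fun H hH hd hc => ⟨hd, hH, ?_, ?_⟩) ?_
  · intro X hX h0 h2
    exact hc X hX 1 fun i hi => by fin_cases i <;> first | exact h0 | exact h2 | exact absurd rfl hi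
  · intro X hX h1 h2
    exact hc X hX 0 fun i hi => by fin_cases i <;> first | exact h1 | exact h2 | exact absurd rfl hi
  · rintro S ⟨hd, hGS, hext, hker⟩
    refine ⟨hd, hGS, fun A B Z hA hB e => hext _ (hE.vec_split_mem e) hA hB, Or.inl ?_⟩
    intro X hX h
    exact hker X hX (h 1 (by decide)) (h 2 (by decide))

theorem isClassifiedBy_coresolving {E : Set (Fin (1 + 2) → C)} (hE : IsConflationClass E)
    {G : ObjectProperty C} (hG : IsNCogenerator E G) :
    IsClassifiedBy E {S | IsDenseSubcategory S ∧ IsCoresolving E G S} (subgroupOf E G) := by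
  refine isClassifiedBy_of hE odd_one (Or.inr hG) (fun H hH hd hc => ⟨hd, hH, ?_, ?_⟩) ?_
  · intro X hX h0 h2
    exact hc X hX 1 fun i hi => by fin_cases i <;> first | exact h0 | exact h2 | exact absurd rfl hi
  · intro X hX h0 h1
    exact hc X hX 2 fun i hi => by fin_cases i <;> first | exact h0 | exact h1 | exact absurd rfl hi
  · rintro S ⟨hd, hGS, hext, hcok⟩
    refine ⟨hd, hGS, fun A B Z hA hB e => hext _ (hE.vec_split_mem e) hA hB, Or.inr ?_⟩
    intro X hX h
    exact hcok X hX (h 0 (by decide)) (h 1 (by decide))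

lemma subgroupOf_isZero (hE : IsConflationClass E) (hn : Odd n) :
    subgroupOf E (fun A : C => IsZero A) = ⊥ := by
  rw [eq_bot_iff, subgroupOf, AddSubgroup.closure_le]
  rintro _ ⟨A, hA, rfl⟩
  exact K0.cls_eq_zero hE hn hA

end Classification

open ZeroObject

/-! ### Triangulated categories -/

section Triangulated

lemma nonempty_pi_walkingPair_iso {C : Type u} [Category.{v} C] [Preadditive C]
    [HasBinaryBiproducts C] (f : WalkingPair → C) :
    Nonempty (∏ᶜ f ≅ f .left ⊞ f .right) :=
  ⟨{ hom := biprod.lift (Pi.π f .left) (Pi.π f .right)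
     inv := Pi.lift fun j => match j with
      | .left => biprod.fst
      | .right => biprod.snd
     hom_inv_id := by
      refine Pi.hom_ext _ _ fun j => ?_
      cases j <;> simp
     inv_hom_id := by ext <;> simp }⟩

variable {C : Type u} [Category.{v} C] [HasZeroObject C] [HasShift C ℤ] [Preadditive C]
  [∀ k : ℤ, (shiftFunctor C k).Additive] [Pretriangulated C]

lemma exists_distTriang_biprod {T T' : Triangle C} (hT : T ∈ distTriang C)
    (hT' : T' ∈ distTriang C) : ∃ U ∈ distTriang C, Nonempty (U.obj₁ ≅ T.obj₁ ⊞ T'.obj₁) ∧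
      Nonempty (U.obj₂ ≅ T.obj₂ ⊞ T'.obj₂) ∧ Nonempty (U.obj₃ ≅ T.obj₃ ⊞ T'.obj₃) := by
  let F : WalkingPair → Triangle C := fun j => match j with
    | .left => T
    | .right => T'
  refine ⟨productTriangle F, productTriangle_distinguished F ?_,
    nonempty_pi_walkingPair_iso fun j => (F j).obj₁,
    nonempty_pi_walkingPair_iso fun j => (F j).obj₂,
    nonempty_pi_walkingPair_iso fun j => (F j).obj₃⟩
  rintro (_ | _)
  · exact hT
  · exact hT'

lemma isConflationClass_triangleTerms : IsConflationClass (triangleTerms C) where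
  zero_mem := by
    refine ⟨_, ⟨_, contractible_distinguished (0 : C), rfl⟩, fun i => ?_⟩
    fin_cases i <;> exact isZero_zero C
  iso_mem := by
    rintro _ ⟨T, hT, rfl⟩ Y e
    obtain ⟨e0⟩ := e 0
    obtain ⟨e1⟩ := e 1
    obtain ⟨e2⟩ := e 2
    change T.obj₁ ≅ Y 0 at e0
    change T.obj₂ ≅ Y 1 at e1
    change T.obj₃ ≅ Y 2 at e2
    refine ⟨Triangle.mk (e0.inv ≫ T.mor₁ ≫ e1.hom) (e1.inv ≫ T.mor₂ ≫ e2.hom)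
      (e2.inv ≫ T.mor₃ ≫ (shiftFunctor C (1 : ℤ)).map e0.hom),
      isomorphic_distinguished _ hT _ (Triangle.isoMk _ _ e0.symm e1.symm e2.symm
        ?_ ?_ ?_), ?_⟩
    · change (e0.inv ≫ T.mor₁ ≫ e1.hom) ≫ e1.inv = e0.inv ≫ T.mor₁
      simp
    · change (e1.inv ≫ T.mor₂ ≫ e2.hom) ≫ e2.inv = e1.inv ≫ T.mor₂
      simp
    · change (e2.inv ≫ T.mor₃ ≫ (shiftFunctor C (1 : ℤ)).map e0.hom) ≫
        (shiftFunctor C (1 : ℤ)).map e0.inv = e2.inv ≫ T.mor₃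
      simp [← Functor.map_comp]
    · funext j
      fin_cases j <;> rfl
  add_mem := by
    rintro _ ⟨T, hT, rfl⟩ W i hi
    obtain rfl | rfl : i = 0 ∨ i = 1 := by lia
    · obtain ⟨U, hU, e⟩ := exists_distTriang_biprod hT (contractible_distinguished W)
      refine ⟨_, ⟨U, hU, rfl⟩, fun j => ?_⟩
      obtain ⟨e1, e2, ⟨e3⟩⟩ := e
      fin_cases j
      · exact e1
      · exact e2
      · exact ⟨e3 ≪≫ (isoBiprodZero (isZero_zero C)).symm⟩
    · obtain ⟨U, hU, e⟩ := exists_distTriang_biprod hT (contractible_distinguished₁ W)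
      refine ⟨_, ⟨U, hU, rfl⟩, fun j => ?_⟩
      obtain ⟨⟨e1⟩, e2, e3⟩ := e
      fin_cases j
      · exact ⟨e1 ≪≫ (isoBiprodZero (isZero_zero C)).symm⟩
      · exact e2
      · exact e3

lemma isNGenerator_isZero_triangleTerms :
    IsNGenerator (triangleTerms C) (fun A : C => IsZero A) := by
  intro A
  obtain ⟨X, f, h, hT⟩ := distinguished_cocone_triangle₁ (0 : 0 ⟶ A)
  refine ⟨_, ⟨_, hT, rfl⟩, ⟨Iso.refl A⟩, fun i h0 h1 => ?_⟩
  fin_cases i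
  · exact absurd rfl h0
  · exact isZero_zero C
  · exact absurd rfl h1

lemma isTriangulated_subcategoryOf (H : AddSubgroup (K0 (triangleTerms C))) :
    (subcategoryOf H).IsTriangulated ∧ (subcategoryOf H).IsClosedUnderIsomorphisms := by
  have hc := isCompleteSubcategory_subcategoryOf H
  have hiso : (subcategoryOf H).IsClosedUnderIsomorphisms := ⟨fun e hA => by
    rwa [subcategoryOf, ← K0.cls_eq_of_iso ⟨e⟩]⟩
  have hzero : ∀ Z : C, IsZero Z → subcategoryOf H Z := fun Z hZ => by
    rw [subcategoryOf, K0.cls_eq_zero isConflationClass_triangleTerms odd_one hZ]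
    exact zero_mem H
  have h₂ : ∀ T ∈ distTriang C, subcategoryOf H T.obj₁ → subcategoryOf H T.obj₃ →
      subcategoryOf H T.obj₂ := fun T hT h0 h2 =>
    hc _ ⟨T, hT, rfl⟩ 1 fun i hi => by
      fin_cases i <;> first | exact h0 | exact h2 | exact absurd rfl hi
  have hshift : ∀ X : C, subcategoryOf H X ↔ subcategoryOf H (X⟦(1 : ℤ)⟧) := fun X =>
    ⟨fun h => hc _ ⟨_, contractible_distinguished₂ X, rfl⟩ 2 fun i hi => by
      fin_cases i <;> first | exact h | exact hzero _ (isZero_zero C) | exact absurd rfl hi,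
    fun h => hc _ ⟨_, contractible_distinguished₂ X, rfl⟩ 0 fun i hi => by
      fin_cases i <;> first | exact h | exact hzero _ (isZero_zero C) | exact absurd rfl hi⟩
  have hshift' : ∀ (k : ℤ) (X : C), subcategoryOf H (X⟦k⟧) ↔ subcategoryOf H (X⟦k + 1⟧) :=
    fun k X => by
      rw [hshift]
      exact (subcategoryOf H).prop_iff_of_iso ((shiftFunctorAdd C k 1).app X).symm
  have hall : ∀ (k : ℤ) (X : C), subcategoryOf H X → subcategoryOf H (X⟦k⟧) := by
    intro k X hX
    induction k using Int.induction_on with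
    | zero => exact (subcategoryOf H).prop_of_iso ((shiftFunctorZero C ℤ).app X).symm hX
    | succ k ih => exact (hshift' _ _).1 ih
    | pred k ih => exact (hshift' _ _).2 (by rwa [sub_add_cancel])
  have := ObjectProperty.IsTriangulatedClosed₂.mk' h₂
  have : (subcategoryOf H).ContainsZero := ⟨0, isZero_zero C, hzero _ (isZero_zero C)⟩
  have : (subcategoryOf H).IsStableUnderShift ℤ := ⟨fun k => ⟨hall k⟩⟩
  exact ⟨{ }, hiso⟩

theorem isClassifiedBy_triangulated : IsClassifiedBy (triangleTerms C)
    {S | IsDenseSubcategory S ∧ S.IsTriangulated ∧ S.IsClosedUnderIsomorphisms} ⊥ := by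
  have hE := isConflationClass_triangleTerms (C := C)
  rw [← subgroupOf_isZero hE odd_one]
  refine isClassifiedBy_of hE odd_one (Or.inl isNGenerator_isZero_triangleTerms)
    (fun H _ hd _ => ⟨hd, isTriangulated_subcategoryOf H⟩) ?_
  rintro S ⟨hd, _, _⟩
  refine ⟨hd, fun Z hZ => ?_, fun A B Z hA hB ⟨e⟩ => ?_, Or.inl ?_⟩
  · obtain ⟨Z', hZ', h⟩ := S.exists_prop_of_containsZero
    exact S.prop_of_iso (hZ'.iso hZ) h
  · exact S.prop_of_iso e.symm (S.ext_of_isTriangulatedClosed₂ _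
      (binaryBiproductTriangle_distinguished A B) hA hB)
  · rintro _ ⟨T, hT, rfl⟩ h
    exact S.ext_of_isTriangulatedClosed₁ T hT (h 1 (by decide)) (h 2 (by decide))

end Triangulated

/-! ### Exact categories -/

section Exact

variable {C : Type u} [Category.{v} C] [Preadditive C] [HasBinaryBiproducts C]

lemma isPushout_biprod_map {A B : C} (f : A ⟶ B) (W : C) :
    IsPushout f (biprod.inl : A ⟶ A ⊞ W) (biprod.inl : B ⟶ B ⊞ W) (biprod.map f (𝟙 W)) :=
  IsPushout.of_isColimit' ⟨by simp⟩ <| PushoutCocone.IsColimit.mk _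
    (fun s => biprod.desc s.inl (biprod.inr ≫ s.inr)) (fun s => by simp)
    (fun s => by ext <;> simp [s.condition])
    (fun s m h1 h2 => by
      ext
      · simpa using h1
      · simp [← h2])

lemma isPullback_biprod_map {B D : C} (g : B ⟶ D) (W : C) :
    IsPullback (biprod.fst : B ⊞ W ⟶ B) (biprod.map g (𝟙 W)) g (biprod.fst : D ⊞ W ⟶ D) :=
  IsPullback.of_isLimit' ⟨by simp⟩ <| PullbackCone.IsLimit.mk _
    (fun s => biprod.lift s.fst (s.snd ≫ biprod.snd)) (fun s => by simp)
    (fun s => by ext <;> simp [s.condition])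
    (fun s m h1 h2 => by
      ext
      · simpa using h1
      · simp [← h2])

/-- Cokernels of parallel sides of a pushout square along `A ⟶ A ⊞ W` agree. -/
lemma nonempty_cokernel_iso_of_isPushout {A B D W B' D' : C} {f : A ⟶ B} {g : B ⟶ D}
    (w : f ≫ g = 0) (hg : IsColimit (CokernelCofork.ofπ g w)) {f' : B ⟶ B'} {i' : A ⊞ W ⟶ B'}
    (h : IsPushout f biprod.inl f' i') {p : B' ⟶ D'} (w' : i' ≫ p = 0)
    (hp : IsColimit (CokernelCofork.ofπ p w')) : Nonempty (D' ≅ D) := by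
  let t : B' ⟶ B := h.desc (𝟙 B) (biprod.desc f 0) (by simp)
  have ht : f' ≫ t = 𝟙 B := h.inl_desc _ _ _
  have ht' : i' ≫ t = biprod.desc f 0 := h.inr_desc _ _ _
  obtain ⟨a, ha⟩ := CokernelCofork.IsColimit.desc' hp (t ≫ g) (by
    rw [reassoc_of% ht']
    ext <;> simp [w])
  obtain ⟨b, hb⟩ := CokernelCofork.IsColimit.desc' hg (f' ≫ p) (by
    rw [reassoc_of% h.w, w', comp_zero])
  dsimp at ha hb
  refine ⟨⟨a, b, ?_, ?_⟩⟩
  · refine Cofork.IsColimit.hom_ext hp ?_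
    dsimp
    rw [reassoc_of% ha, hb, Category.comp_id]
    refine h.hom_ext ?_ ?_
    · rw [reassoc_of% ht]
    · rw [reassoc_of% ht', w']
      ext
      · simp [reassoc_of% h.w, w']
      · simp
  · refine Cofork.IsColimit.hom_ext hg ?_
    dsimp
    rw [reassoc_of% hb, ha, reassoc_of% ht, Category.comp_id]

/-- Kernels of parallel sides of a pullback square along `D ⊞ W ⟶ D` agree. -/
lemma nonempty_kernel_iso_of_isPullback {A B D W B' A' : C} {f : A ⟶ B} {g : B ⟶ D}
    (w : f ≫ g = 0) (hf : IsLimit (KernelFork.ofι f w)) {g' : B' ⟶ B} {p' : B' ⟶ D ⊞ W}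
    (h : IsPullback g' p' g biprod.fst) {i : A' ⟶ B'} (w' : i ≫ p' = 0)
    (hi : IsLimit (KernelFork.ofι i w')) : Nonempty (A' ≅ A) := by
  let t : B ⟶ B' := h.lift (𝟙 B) (biprod.lift g 0) (by simp)
  have ht : t ≫ g' = 𝟙 B := h.lift_fst _ _ _
  have ht' : t ≫ p' = biprod.lift g 0 := h.lift_snd _ _ _
  obtain ⟨a, ha⟩ := KernelFork.IsLimit.lift' hi (f ≫ t) (by
    rw [Category.assoc, ht']
    ext <;> simp [w])
  obtain ⟨b, hb⟩ := KernelFork.IsLimit.lift' hf (i ≫ g') (by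
    rw [Category.assoc, h.w, reassoc_of% w', zero_comp])
  dsimp at ha hb
  refine ⟨⟨b, a, ?_, ?_⟩⟩
  · refine Fork.IsLimit.hom_ext hi ?_
    dsimp
    rw [Category.assoc, ha, reassoc_of% hb, Category.id_comp]
    refine h.hom_ext ?_ ?_
    · simp [ht]
    · rw [Category.assoc, Category.assoc, ht', w']
      ext
      · simp [h.w, reassoc_of% w']
      · simp
  · refine Fork.IsLimit.hom_ext hf ?_
    dsimp
    rw [Category.assoc, hb, reassoc_of% ha, ht, Category.comp_id, Category.id_comp]

/-- The part of the axioms of an exact structure that makes the short exact sequences a class of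
conflations; compositions of inflations or deflations play no role. -/
lemma isConflationClass_exactTerms_of {ℰ : Set (ShortComplex C)}
    (hker : ∀ S ∈ ℰ, Nonempty (IsLimit (KernelFork.ofι S.f S.zero)))
    (hcok : ∀ S ∈ ℰ, Nonempty (IsColimit (CokernelCofork.ofπ S.g S.zero)))
    (hiso : ∀ S S' : ShortComplex C, S ∈ ℰ → Nonempty (S ≅ S') → S' ∈ ℰ)
    (hzero : ∃ S ∈ ℰ, IsZero S.X₁ ∧ IsZero S.X₂ ∧ IsZero S.X₃)
    (hpush : ∀ {A B A' : C} (i : A ⟶ B) (f : A ⟶ A'), IsAdmissibleMono ℰ i →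
      ∃ (B' : C) (f' : B ⟶ B') (i' : A' ⟶ B'), IsPushout i f f' i' ∧ IsAdmissibleMono ℰ i')
    (hpull : ∀ {B D D' : C} (p : B ⟶ D) (g : D' ⟶ D), IsAdmissibleEpi ℰ p →
      ∃ (B' : C) (g' : B' ⟶ B) (p' : B' ⟶ D'), IsPullback g' p' p g ∧ IsAdmissibleEpi ℰ p') :
    IsConflationClass (exactTerms ℰ) where
  zero_mem := by
    obtain ⟨S, hS, h1, h2, h3⟩ := hzero
    refine ⟨_, ⟨S, hS, rfl⟩, fun i => ?_⟩
    fin_cases i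
    exacts [h1, h2, h3]
  iso_mem := by
    rintro _ ⟨S, hS, rfl⟩ Y e
    obtain ⟨e0⟩ := e 0
    obtain ⟨e1⟩ := e 1
    obtain ⟨e2⟩ := e 2
    change S.X₁ ≅ Y 0 at e0
    change S.X₂ ≅ Y 1 at e1
    change S.X₃ ≅ Y 2 at e2
    refine ⟨ShortComplex.mk (e0.inv ≫ S.f ≫ e1.hom) (e1.inv ≫ S.g ≫ e2.hom) (by simp),
      hiso _ _ hS ⟨ShortComplex.isoMk e0 e1 e2 (by simp) (by simp)⟩, ?_⟩
    funext j
    fin_cases j <;> rfl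
  add_mem := by
    rintro _ ⟨S, hS, rfl⟩ W i hi
    obtain rfl | rfl : i = 0 ∨ i = 1 := by lia
    · obtain ⟨B', f', i', h, D', p, w, hS'⟩ := hpush S.f (biprod.inl : S.X₁ ⟶ S.X₁ ⊞ W)
        ⟨_, S.g, S.zero, hS⟩
      refine ⟨_, ⟨_, hS', rfl⟩, fun j => ?_⟩
      fin_cases j
      · exact ⟨Iso.refl _⟩
      · exact ⟨h.isoIsPushout _ _ (isPushout_biprod_map S.f W)⟩
      · exact nonempty_cokernel_iso_of_isPushout S.zero (hcok _ hS).some h w (hcok _ hS').some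
    · obtain ⟨B', g', p', h, A', i, w, hS'⟩ := hpull S.g (biprod.fst : S.X₃ ⊞ W ⟶ S.X₃)
        ⟨_, S.f, S.zero, hS⟩
      refine ⟨_, ⟨_, hS', rfl⟩, fun j => ?_⟩
      fin_cases j
      · exact nonempty_kernel_iso_of_isPullback S.zero (hker _ hS).some h w (hker _ hS').some
      · exact ⟨h.isoIsPullback _ _ (isPullback_biprod_map S.g W)⟩
      · exact ⟨Iso.refl _⟩

lemma IsExactStructure.isConflationClass [HasZeroObject C] {ℰ : Set (ShortComplex C)}
    (h : IsExactStructure ℰ) : IsConflationClass (exactTerms ℰ) := by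
  refine isConflationClass_exactTerms_of h.isKernel h.isCokernel h.iso_mem ?_ h.exists_pushout
    h.exists_pullback
  obtain ⟨D, p, w, hS⟩ := h.id_mono (0 : C)
  refine ⟨_, hS, isZero_zero C, isZero_zero C, ?_⟩
  rw [IsZero.iff_id_eq_zero]
  exact Cofork.IsColimit.hom_ext (h.isCokernel _ hS).some ((isZero_zero C).eq_of_src _ _)

end Exact

/-! ### Extriangulated categories -/

section Extriangulated

variable {C : Type u} [Category.{v} C] [Preadditive C] [HasZeroObject C] [HasBinaryBiproducts C]

namespace ExtriangulatedStructure

variable (𝒯 : ExtriangulatedStructure.{u, v, w} C)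

lemma push_push {A A' A'' D : C} (a : A ⟶ A') (a' : A' ⟶ A'') (δ : Extension 𝒯.𝔼 D A) :
    push 𝒯.𝔼 a' (push 𝒯.𝔼 a δ) = push 𝒯.𝔼 (a ≫ a') δ := by
  simp [push]

lemma push_id {A D : C} (δ : Extension 𝒯.𝔼 D A) : push 𝒯.𝔼 (𝟙 A) δ = δ := by
  simp [push]

lemma pull_pull {A D D' D'' : C} (c : D' ⟶ D) (c' : D'' ⟶ D') (δ : Extension 𝒯.𝔼 D A) :
    pull 𝒯.𝔼 c' (pull 𝒯.𝔼 c δ) = pull 𝒯.𝔼 (c' ≫ c) δ := by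
  simp [pull]

lemma pull_id {A D : C} (δ : Extension 𝒯.𝔼 D A) : pull 𝒯.𝔼 (𝟙 D) δ = δ := by
  simp [pull]

lemma realizes_of_iso {A B D B' : C} {δ : Extension 𝒯.𝔼 D A} {x : A ⟶ B} {y : B ⟶ D}
    (h : 𝒯.Realizes δ x y) (b : B ≅ B') : 𝒯.Realizes δ (x ≫ b.hom) (b.inv ≫ y) :=
  (𝒯.realizes_iff δ x y _ _ h).2 ⟨b, rfl, by simp⟩

/-- In a conflation the deflation is a weak cokernel of the inflation: apply (ET3) to a morphism to
the split conflation `0 ⟶ 0 ⊞ T ⟶ T`. -/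
lemma exists_factor {A B D T : C} {δ : Extension 𝒯.𝔼 D A} {x : A ⟶ B} {y : B ⟶ D}
    (h : 𝒯.Realizes δ x y) (t : B ⟶ T) (ht : x ≫ t = 0) : ∃ c : D ⟶ T, y ≫ c = t := by
  obtain ⟨c, hc, -⟩ := 𝒯.et3 δ 0 x y _ _ (0 : A ⟶ (0 : C)) (t ≫ biprod.inr) h
    (𝒯.realizes_zero (0 : C) T) (by rw [reassoc_of% ht]; simp)
  exact ⟨c, by simpa using hc⟩

/-- An endomorphism of a conflation that is the identity on both ends is an isomorphism, because
its difference to the identity has square zero. -/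
lemma isIso_of_endomorphism {A B D : C} {δ : Extension 𝒯.𝔼 D A} {x : A ⟶ B} {y : B ⟶ D}
    (h : 𝒯.Realizes δ x y) (b : B ⟶ B) (hx : x ≫ b = x) (hy : b ≫ y = y) : IsIso b := by
  obtain ⟨c, hc⟩ := 𝒯.exists_factor h (b - 𝟙 B) (by simp [hx])
  have hsq : (b - 𝟙 B) ≫ (b - 𝟙 B) = 0 := by
    conv_lhs => arg 2; rw [← hc]
    simp [reassoc_of% hy]
  have hsq' : b ≫ b - b - (b - 𝟙 B) = 0 := by
    simpa [Preadditive.sub_comp, Preadditive.comp_sub] using hsq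
  refine ⟨𝟙 B + 𝟙 B - b, ?_, ?_⟩
  · rw [Preadditive.comp_sub, Preadditive.comp_add, Category.comp_id, ← sub_eq_zero, ← neg_eq_zero,
      ← hsq']
    abel
  · rw [Preadditive.sub_comp, Preadditive.add_comp, Category.id_comp, ← sub_eq_zero, ← neg_eq_zero,
      ← hsq']
    abel

/-- The middle term of a conflation is determined by the extension: comparison morphisms in both
directions compose to endomorphisms that are the identity on both ends. -/
lemma exists_iso_of_realizes {A B D A' B' D' : C} {δ : Extension 𝒯.𝔼 D A}
    {δ' : Extension 𝒯.𝔼 D' A'} {x : A ⟶ B} {y : B ⟶ D} {x' : A' ⟶ B'} {y' : B' ⟶ D'}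
    (h : 𝒯.Realizes δ x y) (h' : 𝒯.Realizes δ' x' y') (a : A ≅ A') (c : D ≅ D')
    (hδ : push 𝒯.𝔼 a.hom δ = pull 𝒯.𝔼 c.hom δ') :
    Nonempty (B ≅ B') := by
  have hδ' : push 𝒯.𝔼 a.inv δ' = pull 𝒯.𝔼 c.inv δ := by
    have h1 : δ' = pull 𝒯.𝔼 c.inv (push 𝒯.𝔼 a.hom δ) := by
      rw [hδ, pull_pull, c.inv_hom_id, pull_id]
    have h2 : push 𝒯.𝔼 a.inv (pull 𝒯.𝔼 c.inv (push 𝒯.𝔼 a.hom δ)) =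
        pull 𝒯.𝔼 c.inv (push 𝒯.𝔼 a.inv (push 𝒯.𝔼 a.hom δ)) := by
      simp [push, pull]
    rw [h1, h2, push_push, a.hom_inv_id, push_id]
  obtain ⟨b, hb, hb'⟩ := 𝒯.exists_lift δ δ' x y x' y' a.hom c.hom h h' hδ
  obtain ⟨d, hd, hd'⟩ := 𝒯.exists_lift δ' δ x' y' x y a.inv c.inv h' h hδ'
  have h1 := 𝒯.isIso_of_endomorphism h (b ≫ d) (by rw [reassoc_of% hb, hd]; simp)
    (by rw [Category.assoc, ← hd', ← reassoc_of% hb']; simp)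
  have h2 := 𝒯.isIso_of_endomorphism h' (d ≫ b) (by rw [reassoc_of% hd, hb]; simp)
    (by rw [Category.assoc, ← hb', ← reassoc_of% hd']; simp)
  have : IsSplitMono b := ⟨⟨d ≫ inv (b ≫ d), by rw [← Category.assoc, IsIso.hom_inv_id]⟩⟩
  have : Epi b := epi_of_epi d b
  have := isIso_of_epi_of_isSplitMono b
  exact ⟨asIso b⟩

lemma isConflationClass : IsConflationClass (extriangleTerms 𝒯) where
  zero_mem := by
    refine ⟨_, ⟨_, _, _, _, _, _, 𝒯.realizes_zero 0 0, rfl⟩, fun i => ?_⟩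
    fin_cases i
    · exact isZero_zero C
    · exact (isZero_zero C).of_iso (isoBiprodZero (isZero_zero C)).symm
    · exact isZero_zero C
  iso_mem := by
    rintro _ ⟨A, B, D, δ, x, y, h, rfl⟩ Y e
    obtain ⟨a⟩ := e 0
    obtain ⟨b⟩ := e 1
    obtain ⟨c⟩ := e 2
    change A ≅ Y 0 at a
    change B ≅ Y 1 at b
    change D ≅ Y 2 at c
    obtain ⟨B', x', y', h'⟩ := 𝒯.exists_realizes (pull 𝒯.𝔼 c.inv (push 𝒯.𝔼 a.hom δ))
    obtain ⟨b'⟩ := 𝒯.exists_iso_of_realizes h h' a c (by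
      rw [pull_pull, c.hom_inv_id, pull_id])
    refine ⟨_, _, _, _, _, _, 𝒯.realizes_of_iso h' (b'.symm ≪≫ b), ?_⟩
    funext j
    fin_cases j <;> rfl
  add_mem := by
    rintro _ ⟨A, B, D, δ, x, y, h, rfl⟩ W i hi
    obtain rfl | rfl : i = 0 ∨ i = 1 := by lia
    · refine ⟨_, ⟨_, _, _, _, _, _,
        𝒯.realizes_sum _ _ _ _ _ _ h (𝒯.realizes_zero W 0), rfl⟩, fun j => ?_⟩
      fin_cases j
      · exact ⟨Iso.refl _⟩
      · exact ⟨biprod.mapIso (Iso.refl _) (isoBiprodZero (isZero_zero C)).symm⟩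
      · exact ⟨(isoBiprodZero (isZero_zero C)).symm⟩
    · refine ⟨_, ⟨_, _, _, _, _, _,
        𝒯.realizes_sum _ _ _ _ _ _ h (𝒯.realizes_zero 0 W), rfl⟩, fun j => ?_⟩
      fin_cases j
      · exact ⟨(isoBiprodZero (isZero_zero C)).symm⟩
      · exact ⟨biprod.mapIso (Iso.refl _) (isoZeroBiprod (isZero_zero C)).symm⟩
      · exact ⟨Iso.refl _⟩

end ExtriangulatedStructure

end Extriangulated

/-! ### Direct sums with contractible sequences of morphisms -/

section ComposableArrows

variable {C : Type u} [Category.{v} C]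

/-- The sequence `0 ⟶ ⋯ ⟶ W = W ⟶ ⋯ ⟶ 0` with the two terms `W` in degrees `i` and `i + 1`. It is
determined by these properties up to isomorphism. -/
structure IsContractibleSeq {m : ℕ} (X : ComposableArrows C m) (W : C) (i : ℕ) (hi : i < m) :
    Prop where
  isIso : IsIso (X.map' i (i + 1))
  isZero : ∀ j : Fin (m + 1), (j : ℕ) ≠ i → (j : ℕ) ≠ i + 1 → IsZero (X.obj j)
  iso : Nonempty (X.obj' i ≅ W)

lemma IsContractibleSeq.nonempty_iso {m : ℕ} {X : ComposableArrows C m} {W : C} {i : ℕ} {hi : i < m}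
    (h : IsContractibleSeq X W i hi) (j : Fin (m + 1)) (hj : (j : ℕ) = i ∨ (j : ℕ) = i + 1) :
    Nonempty (X.obj j ≅ W) := by
  obtain ⟨e⟩ := h.iso
  have := h.isIso
  have e' := asIso (X.map' i (i + 1) _ _)
  obtain ⟨j, hj'⟩ := j
  dsimp at hj
  obtain rfl | rfl := hj
  · exact ⟨e⟩
  · exact ⟨e'.symm ≪≫ e⟩

variable [Preadditive C]

lemma exists_isContractibleSeq [HasZeroObject C] (m : ℕ) (W : C) (i : ℕ) (hi : i < m) :
    ∃ X : ComposableArrows C m, IsContractibleSeq X W i hi := by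
  let obj : Fin (m + 1) → C := fun j => if (j : ℕ) = i ∨ (j : ℕ) = i + 1 then W else 0
  have hobj : ∀ j : Fin (m + 1), (j : ℕ) = i ∨ (j : ℕ) = i + 1 → obj j = W := fun j h => if_pos h
  let d : ∀ j : Fin m, obj j.castSucc ⟶ obj j.succ := fun j =>
    if h : (j : ℕ) = i then
      eqToHom ((hobj _ (Or.inl h)).trans (hobj _ (Or.inr (by simpa using h))).symm) else 0
  refine ⟨ComposableArrows.mkOfObjOfMapSucc obj d, ?_, ?_, ⟨eqToIso (hobj ⟨i, _⟩ (Or.inl rfl))⟩⟩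
  · rw [ComposableArrows.mkOfObjOfMapSucc_map_succ obj d i hi]
    have hd : IsIso (d ⟨i, hi⟩) := by
      rw [show d ⟨i, hi⟩ = eqToHom _ from dif_pos rfl]
      infer_instance
    exact hd
  · intro j h1 h2
    rw [ComposableArrows.mkOfObjOfMapSucc_obj]
    simp only [obj, h1, h2, or_self, if_false]
    exact isZero_zero C

variable [HasBinaryBiproducts C]

instance (m : ℕ) : HasBinaryBiproducts (ComposableArrows C m) :=
  HasBinaryBiproducts.of_hasBinaryProducts

section Biprod

variable {m : ℕ} (X Y : ComposableArrows C m) (j : Fin (m + 1))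

lemma inl_fst_app : (biprod.inl : X ⟶ X ⊞ Y).app j ≫ (biprod.fst : X ⊞ Y ⟶ X).app j = 𝟙 _ := by
  rw [← NatTrans.comp_app, biprod.inl_fst, NatTrans.id_app]

lemma inl_snd_app : (biprod.inl : X ⟶ X ⊞ Y).app j ≫ (biprod.snd : X ⊞ Y ⟶ Y).app j = 0 := by
  rw [← NatTrans.comp_app, biprod.inl_snd]; rfl

lemma inr_fst_app : (biprod.inr : Y ⟶ X ⊞ Y).app j ≫ (biprod.fst : X ⊞ Y ⟶ X).app j = 0 := by
  rw [← NatTrans.comp_app, biprod.inr_fst]; rfl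

lemma inr_snd_app : (biprod.inr : Y ⟶ X ⊞ Y).app j ≫ (biprod.snd : X ⊞ Y ⟶ Y).app j = 𝟙 _ := by
  rw [← NatTrans.comp_app, biprod.inr_snd, NatTrans.id_app]

lemma fst_inl_add_snd_inr_app :
    (biprod.fst : X ⊞ Y ⟶ X).app j ≫ (biprod.inl : X ⟶ X ⊞ Y).app j +
      (biprod.snd : X ⊞ Y ⟶ Y).app j ≫ (biprod.inr : Y ⟶ X ⊞ Y).app j = 𝟙 _ := by
  rw [← NatTrans.comp_app, ← NatTrans.comp_app, ← NatTrans.app_add, biprod.total, NatTrans.id_app]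

/-- Direct sums of sequences are computed termwise. -/
def biprodObjIso : (X ⊞ Y).obj j ≅ X.obj j ⊞ Y.obj j where
  hom := biprod.lift ((biprod.fst : X ⊞ Y ⟶ X).app j) ((biprod.snd : X ⊞ Y ⟶ Y).app j)
  inv := biprod.desc ((biprod.inl : X ⟶ X ⊞ Y).app j) ((biprod.inr : Y ⟶ X ⊞ Y).app j)
  hom_inv_id := by rw [biprod.lift_desc, fst_inl_add_snd_inr_app]
  inv_hom_id := by
    ext <;> simp [inl_fst_app, inl_snd_app, inr_fst_app, inr_snd_app]

lemma isIso_inl_app (h : IsZero (Y.obj j)) : IsIso ((biprod.inl : X ⟶ X ⊞ Y).app j) :=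
  ⟨(biprod.fst : X ⊞ Y ⟶ X).app j, inl_fst_app X Y j, by
    rw [← fst_inl_add_snd_inr_app, h.eq_of_tgt ((biprod.snd : X ⊞ Y ⟶ Y).app j) 0, zero_comp,
      add_zero]⟩

end Biprod

lemma IsContractibleSeq.nonempty_biprod_iso [HasZeroObject C] {m : ℕ} {X Y : ComposableArrows C m}
    {W : C} {i : ℕ} {hi : i < m} (h : IsContractibleSeq Y W i hi) (j : Fin (m + 1)) :
    Nonempty ((X ⊞ Y).obj j ≅
      if (j : ℕ) = i ∨ (j : ℕ) = i + 1 then X.obj j ⊞ W else X.obj j) := by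
  split_ifs with hj
  · obtain ⟨e⟩ := h.nonempty_iso j hj
    exact ⟨biprodObjIso X Y j ≪≫ biprod.mapIso (Iso.refl _) e⟩
  · have := isIso_inl_app X Y j (h.isZero j (by tauto) (by tauto))
    exact ⟨(asIso ((biprod.inl : X ⟶ X ⊞ Y).app j)).symm⟩

end ComposableArrows

/-! ### `n`-exact categories -/

section NExact

variable {C : Type u} [Category.{v} C] [Preadditive C] {n : ℕ}

/-- Being an `n`-kernel passes to any sequence that is built from `X` and `Y` as a direct summand of
their direct sum. -/
lemma IsNKernel.of_decomposition {X Y Z : ComposableArrows C (n + 1)} (hX : IsNKernel X)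
    (hY : IsNKernel Y) (inl : X ⟶ Z) (inr : Y ⟶ Z) (fst : Z ⟶ X) (snd : Z ⟶ Y)
    (total : fst ≫ inl + snd ≫ inr = 𝟙 Z) : IsNKernel Z := by
  have tot : ∀ j, fst.app j ≫ inl.app j + snd.app j ≫ inr.app j = 𝟙 (Z.obj j) := fun j => by
    rw [← NatTrans.comp_app, ← NatTrans.comp_app, ← NatTrans.app_add, total, NatTrans.id_app]
  have ext_tgt : ∀ {W : C} {j} (g : W ⟶ Z.obj j), g ≫ fst.app j = 0 → g ≫ snd.app j = 0 →
      g = 0 := fun g h1 h2 => by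
    rw [← Category.comp_id g, ← tot, Preadditive.comp_add, reassoc_of% h1, reassoc_of% h2]
    simp
  refine ⟨Preadditive.mono_of_cancel_zero _ fun g hg => ?_, fun i hi W g => ⟨fun hg => ?_, ?_⟩⟩
  · have := hX.1
    have := hY.1
    apply ext_tgt
    · rw [← cancel_mono (X.map' 0 1 _ _), Category.assoc, ← NatTrans.naturality, zero_comp,
        reassoc_of% hg, zero_comp]
    · rw [← cancel_mono (Y.map' 0 1 _ _), Category.assoc, ← NatTrans.naturality, zero_comp,
        reassoc_of% hg, zero_comp]
  · obtain ⟨a, ha⟩ := (hX.2 i hi W (g ≫ fst.app _)).1 (by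
      rw [Category.assoc, ← NatTrans.naturality, reassoc_of% hg, zero_comp])
    obtain ⟨b, hb⟩ := (hY.2 i hi W (g ≫ snd.app _)).1 (by
      rw [Category.assoc, ← NatTrans.naturality, reassoc_of% hg, zero_comp])
    refine ⟨a ≫ inl.app _ + b ≫ inr.app _, ?_⟩
    rw [Preadditive.add_comp, Category.assoc, Category.assoc, ← NatTrans.naturality,
      ← NatTrans.naturality, reassoc_of% ha, reassoc_of% hb, ← Preadditive.comp_add]
    exact (g ≫= tot _).trans (Category.comp_id g)
  · rintro ⟨a, rfl⟩
    apply ext_tgt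
    · rw [Category.assoc, Category.assoc, NatTrans.naturality, NatTrans.naturality_assoc,
        ← Category.assoc]
      have := (hX.2 i hi W ((a ≫ fst.app _) ≫ X.map' i (i + 1))).2 ⟨_, rfl⟩
      rwa [Category.assoc] at this
    · rw [Category.assoc, Category.assoc, NatTrans.naturality, NatTrans.naturality_assoc,
        ← Category.assoc]
      have := (hY.2 i hi W ((a ≫ snd.app _) ≫ Y.map' i (i + 1))).2 ⟨_, rfl⟩
      rwa [Category.assoc] at this

lemma IsNCokernel.of_decomposition {X Y Z : ComposableArrows C (n + 1)} (hX : IsNCokernel X)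
    (hY : IsNCokernel Y) (inl : X ⟶ Z) (inr : Y ⟶ Z) (fst : Z ⟶ X) (snd : Z ⟶ Y)
    (total : fst ≫ inl + snd ≫ inr = 𝟙 Z) : IsNCokernel Z := by
  have tot : ∀ j, fst.app j ≫ inl.app j + snd.app j ≫ inr.app j = 𝟙 (Z.obj j) := fun j => by
    rw [← NatTrans.comp_app, ← NatTrans.comp_app, ← NatTrans.app_add, total, NatTrans.id_app]
  have ext_src : ∀ {W : C} {j} (g : Z.obj j ⟶ W), inl.app j ≫ g = 0 → inr.app j ≫ g = 0 →
      g = 0 := fun g h1 h2 => by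
    rw [← Category.id_comp g, ← tot, Preadditive.add_comp, Category.assoc, Category.assoc, h1, h2]
    simp
  refine ⟨Preadditive.epi_of_cancel_zero _ fun g hg => ?_, fun i hi W g => ⟨fun hg => ?_, ?_⟩⟩
  · have := hX.1
    have := hY.1
    apply ext_src
    · rw [← cancel_epi (X.map' n (n + 1) _ _), NatTrans.naturality_assoc, hg, comp_zero,
        comp_zero]
    · rw [← cancel_epi (Y.map' n (n + 1) _ _), NatTrans.naturality_assoc, hg, comp_zero,
        comp_zero]
  · obtain ⟨a, ha⟩ := (hX.2 i hi W (inl.app _ ≫ g)).1 (by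
      rw [NatTrans.naturality_assoc, hg, comp_zero])
    obtain ⟨b, hb⟩ := (hY.2 i hi W (inr.app _ ≫ g)).1 (by
      rw [NatTrans.naturality_assoc, hg, comp_zero])
    refine ⟨fst.app _ ≫ a + snd.app _ ≫ b, ?_⟩
    rw [Preadditive.comp_add, NatTrans.naturality_assoc,
      NatTrans.naturality_assoc, ha, hb, ← Category.assoc, ← Category.assoc,
      ← Preadditive.add_comp]
    exact (tot _ =≫ g).trans (Category.id_comp g)
  · rintro ⟨a, rfl⟩
    apply ext_src
    · rw [← NatTrans.naturality_assoc, ← NatTrans.naturality_assoc]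
      exact (hX.2 i hi W _).2 ⟨_, rfl⟩
    · rw [← NatTrans.naturality_assoc, ← NatTrans.naturality_assoc]
      exact (hY.2 i hi W _).2 ⟨_, rfl⟩

lemma IsNExactSeq.of_iso {X Y : ComposableArrows C (n + 1)} (hX : IsNExactSeq X) (e : X ≅ Y) :
    IsNExactSeq Y :=
  ⟨hX.1.of_decomposition hX.1 e.hom 0 e.inv 0 (by simp),
    hX.2.of_decomposition hX.2 e.hom 0 e.inv 0 (by simp)⟩

lemma IsNExactSeq.directSum [HasBinaryBiproducts C] {X Y : ComposableArrows C (n + 1)}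
    (hX : IsNExactSeq X) (hY : IsNExactSeq Y) : IsNExactSeq (X ⊞ Y) :=
  ⟨hX.1.of_decomposition hY.1 biprod.inl biprod.inr biprod.fst biprod.snd biprod.total,
    hX.2.of_decomposition hY.2 biprod.inl biprod.inr biprod.fst biprod.snd biprod.total⟩

lemma IsContractibleSeq.isNExactSeq {X : ComposableArrows C (n + 1)} {W : C} {k : ℕ}
    {hk : k < n + 1} (h : IsContractibleSeq X W k hk) : IsNExactSeq X := by
  have hiso : ∀ (i j : ℕ) (hij : j = i + 1) (hj : j < n + 2), i = k →
      IsIso (X.map' i j) := by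
    rintro i _ rfl _ rfl
    exact h.isIso
  refine ⟨⟨?_, fun i hi V g => ?_⟩, ⟨?_, fun i hi V g => ?_⟩⟩
  · by_cases hk0 : 0 = k
    · have := hiso 0 1 rfl (by lia) hk0
      infer_instance
    · exact Preadditive.mono_of_cancel_zero _ fun g _ => (h.isZero _ hk0 (by simp)).eq_of_tgt _ _
  · by_cases h1 : i = k
    · have := hiso i (i + 1) rfl (by lia) h1
      have hz := h.isZero ⟨i + 2, by lia⟩ (by simp; lia) (by simp; lia)
      exact ⟨fun _ => ⟨g ≫ inv (X.map' i (i + 1) _ _), by simp⟩, fun _ => hz.eq_of_tgt _ _⟩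
    · by_cases h2 : i + 1 = k
      · have := hiso (i + 1) (i + 2) rfl (by lia) h2
        have hz := h.isZero ⟨i, by lia⟩ (by simp; lia) (by simp; lia)
        have hg : g ≫ X.map' (i + 1) (i + 2) = 0 ↔ g = 0 :=
          ⟨fun hg => by rwa [← cancel_mono (X.map' (i + 1) (i + 2)), zero_comp],
            fun hg => by rw [hg, zero_comp]⟩
        rw [hg]
        refine ⟨fun hg => ⟨0, by rw [hg, zero_comp]⟩, ?_⟩
        rintro ⟨a, rfl⟩
        rw [hz.eq_of_tgt a 0, zero_comp]
      · have hz := h.isZero ⟨i + 1, by lia⟩ (by simp; lia) (by simp; lia)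
        exact ⟨fun _ => ⟨0, hz.eq_of_tgt _ _⟩, fun _ => by rw [hz.eq_of_tgt g 0, zero_comp]⟩
  · by_cases hkn : n = k
    · have := hiso n (n + 1) rfl (by lia) hkn
      infer_instance
    · exact Preadditive.epi_of_cancel_zero _ fun g _ =>
        (h.isZero _ (by simp; lia) (by simp; lia)).eq_of_src _ _
  · by_cases h1 : i = k
    · have := hiso i (i + 1) rfl (by lia) h1
      have hz := h.isZero ⟨i + 2, by lia⟩ (by simp; lia) (by simp; lia)
      have hg : X.map' i (i + 1) ≫ g = 0 ↔ g = 0 :=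
        ⟨fun hg => by rwa [← cancel_epi (X.map' i (i + 1)), comp_zero],
          fun hg => by rw [hg, comp_zero]⟩
      rw [hg]
      refine ⟨fun hg => ⟨0, by rw [hg, comp_zero]⟩, ?_⟩
      rintro ⟨a, rfl⟩
      rw [hz.eq_of_src a 0, comp_zero]
    · by_cases h2 : i + 1 = k
      · have := hiso (i + 1) (i + 2) rfl (by lia) h2
        have hz := h.isZero ⟨i, by lia⟩ (by simp; lia) (by simp; lia)
        exact ⟨fun _ => ⟨inv (X.map' (i + 1) (i + 2) _ _) ≫ g, by simp⟩, fun _ => hz.eq_of_src _ _⟩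
      · have hz := h.isZero ⟨i + 1, by lia⟩ (by simp; lia) (by simp; lia)
        exact ⟨fun _ => ⟨0, hz.eq_of_src _ _⟩, fun _ => by rw [hz.eq_of_src g 0, comp_zero]⟩

namespace IsNExactStructure

variable [HasBinaryBiproducts C] {𝒳 : Set (ComposableArrows C (n + 1))}

lemma mem_of_iso (h : IsNExactStructure 𝒳) {X Y : ComposableArrows C (n + 1)} (hX : X ∈ 𝒳)
    (e : X ≅ Y) : Y ∈ 𝒳 :=
  (h.mem_iff_of_weakIso X Y e.hom (h.isNExactSeq X hX) ((h.isNExactSeq X hX).of_iso e)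
    (Or.inl ⟨0, by lia, inferInstance, inferInstance⟩)).1 hX

/-- For `n ≥ 2` the inclusion of `X` into the direct sum with a contractible sequence is a weak
isomorphism, as two cyclically consecutive degrees avoid those of the contractible sequence. -/
lemma biprod_mem (h : IsNExactStructure 𝒳) (hn : 2 ≤ n) {X Y : ComposableArrows C (n + 1)}
    (hX : X ∈ 𝒳) {W : C} {k : ℕ} {hk : k < n + 1} (hY : IsContractibleSeq Y W k hk) :
    (X ⊞ Y) ∈ 𝒳 := by
  have hiso : ∀ j : Fin (n + 2), (j : ℕ) ≠ k → (j : ℕ) ≠ k + 1 →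
      IsIso ((biprod.inl : X ⟶ X ⊞ Y).app j) := fun j h1 h2 =>
    isIso_inl_app X Y j (hY.isZero j h1 h2)
  refine (h.mem_iff_of_weakIso X (X ⊞ Y) biprod.inl (h.isNExactSeq X hX)
    ((h.isNExactSeq X hX).directSum hY.isNExactSeq) ?_).1 hX
  rcases k with _ | _ | k
  · exact Or.inl ⟨2, by lia, hiso _ (by simp) (by simp), hiso _ (by simp) (by simp)⟩
  · exact Or.inr ⟨hiso _ (by simp; lia) (by simp; lia), hiso _ (by simp) (by simp)⟩
  · exact Or.inl ⟨0, by lia, hiso _ (by simp) (by simp), hiso _ (by simp) (by simp)⟩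

/-- The classes of conflations of an `n`-exact structure are closed under isomorphisms of terms. -/
lemma iso_mem_nExactTerms (h : IsNExactStructure 𝒳) (X : Fin (n + 2) → C) (hX : X ∈ nExactTerms 𝒳)
    (Y : Fin (n + 2) → C) (e : ∀ i, Nonempty (X i ≅ Y i)) : Y ∈ nExactTerms 𝒳 := by
  obtain ⟨X, hX, rfl⟩ := hX
  exact ⟨_, h.mem_of_iso hX (X.isoCopyObj Y fun i => (e i).some), rfl⟩

section One

variable {𝒳 : Set (ComposableArrows C (1 + 1))}

/-- The short complexes that are the `1`-exact sequences of `𝒳`. -/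
def shortComplexes (𝒳 : Set (ComposableArrows C (1 + 1))) : Set (ShortComplex C) :=
  {S | ComposableArrows.mk₂ S.f S.g ∈ 𝒳}

lemma exactTerms_shortComplexes (h : IsNExactStructure 𝒳) :
    exactTerms (shortComplexes 𝒳) = nExactTerms 𝒳 := by
  ext X
  constructor
  · rintro ⟨S, hS, rfl⟩
    refine ⟨_, hS, ?_⟩
    funext j
    fin_cases j <;> rfl
  · rintro ⟨Y, hY, rfl⟩
    have hw : Y.map' 0 1 ≫ Y.map' 1 2 = 0 :=
      ((h.isNExactSeq Y hY).1.2 0 one_pos _ _).2 ⟨𝟙 _, Category.id_comp _⟩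
    refine ⟨ShortComplex.mk (Y.map' 0 1) (Y.map' 1 2) hw,
      h.mem_of_iso hY (ComposableArrows.isoMk₂ (Iso.refl _) (Iso.refl _) (Iso.refl _)
        ((Category.comp_id _).trans (Category.id_comp _).symm)
        ((Category.comp_id _).trans (Category.id_comp _).symm)), ?_⟩
    funext j
    fin_cases j <;> rfl

lemma isAdmissibleMono_iff (h : IsNExactStructure 𝒳) {A B : C} (f : A ⟶ B) :
    IsAdmissibleMono (shortComplexes 𝒳) f ↔ IsNAdmissibleMono 𝒳 f := by
  constructor
  · rintro ⟨D, p, w, hS⟩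
    exact ⟨_, hS, ⟨Iso.refl _⟩⟩
  · rintro ⟨X, hX, ⟨e⟩⟩
    have hw : X.map' 0 1 ≫ X.map' 1 2 = 0 :=
      ((h.isNExactSeq X hX).1.2 0 one_pos _ _).2 ⟨𝟙 _, Category.id_comp _⟩
    let e0 : X.obj' 0 ≅ A := Arrow.leftFunc.mapIso e
    let e1 : X.obj' 1 ≅ B := Arrow.rightFunc.mapIso e
    have he : e0.hom ≫ f = X.map' 0 1 ≫ e1.hom := e.hom.w
    refine ⟨X.obj' 2, e1.inv ≫ X.map' 1 2, ?_,
      h.mem_of_iso hX (ComposableArrows.isoMk₂ e0 e1 (Iso.refl _) he.symm ?_)⟩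
    · rw [← cancel_epi e0.hom, reassoc_of% he, e1.hom_inv_id_assoc, hw, comp_zero]
    · change X.map' 1 2 ≫ 𝟙 _ = e1.hom ≫ e1.inv ≫ X.map' 1 2
      rw [e1.hom_inv_id_assoc, Category.comp_id]

lemma isAdmissibleEpi_iff (h : IsNExactStructure 𝒳) {B D : C} (g : B ⟶ D) :
    IsAdmissibleEpi (shortComplexes 𝒳) g ↔ IsNAdmissibleEpi 𝒳 g := by
  constructor
  · rintro ⟨A, i, w, hS⟩
    exact ⟨_, hS, ⟨Iso.refl _⟩⟩
  · rintro ⟨X, hX, ⟨e⟩⟩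
    have hw : X.map' 0 1 ≫ X.map' 1 2 = 0 :=
      ((h.isNExactSeq X hX).1.2 0 one_pos _ _).2 ⟨𝟙 _, Category.id_comp _⟩
    let e1 : X.obj' 1 ≅ B := Arrow.leftFunc.mapIso e
    let e2 : X.obj' 2 ≅ D := Arrow.rightFunc.mapIso e
    have he : e1.hom ≫ g = X.map' 1 2 ≫ e2.hom := e.hom.w
    refine ⟨X.obj' 0, X.map' 0 1 ≫ e1.hom, ?_,
      h.mem_of_iso hX (ComposableArrows.isoMk₂ (Iso.refl _) e1 e2 ?_ he.symm)⟩
    · rw [Category.assoc, he, reassoc_of% hw, zero_comp]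
    · exact (Category.id_comp _).symm

/-- A `1`-pushout diagram is a pushout square. -/
lemma isPushout_of_isNPushout {X Y : ComposableArrows C 1} {φ : X ⟶ Y} (h : IsNPushout φ) :
    IsPushout (X.map' 0 1) (ComposableArrows.app' φ 0) (ComposableArrows.app' φ 1)
      (Y.map' 0 1) := by
  obtain ⟨Z, ⟨c⟩, hZ⟩ := h
  have := c.isIso_p
  have := c.isIso_q
  have := c.isIso_lift 0 one_pos
  have hd0p := c.map_p 0 one_pos
  have hd0q := c.map_q_zero
  have hd1 := c.map_q 0 one_pos
  have hepi : Epi (Z.map' 1 2) := hZ.1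
  -- the inclusions of the summands `X₁` and `Y₀` of `Z₁`
  let L := biprod.lift (c.p 1 le_rfl) (c.q 0 (by lia))
  have hL : IsIso L := c.isIso_lift 0 one_pos
  have hp : c.p 1 le_rfl = L ≫ biprod.fst := (biprod.lift_fst _ _).symm
  have hq : c.q 0 (by lia) = L ≫ biprod.snd := (biprod.lift_snd _ _).symm
  obtain ⟨σ, hσp, hσq⟩ : ∃ σ : X.obj 1 ⟶ Z.obj 1,
      σ ≫ c.p 1 le_rfl = 𝟙 _ ∧ σ ≫ c.q 0 (by lia) = 0 :=
    ⟨biprod.inl ≫ inv L, by simp [hp], by simp [hq]⟩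
  obtain ⟨τ, hτp, hτq⟩ : ∃ τ : Y.obj 0 ⟶ Z.obj 1,
      τ ≫ c.p 1 le_rfl = 0 ∧ τ ≫ c.q 0 (by lia) = 𝟙 _ :=
    ⟨biprod.inr ≫ inv L, by simp [hp], by simp [hq]⟩
  have hφ : σ ≫ Z.map' 1 2 ≫ c.q 1 le_rfl = ComposableArrows.app' φ 1 := by
    rw [hd1, Preadditive.comp_add, reassoc_of% hσp, reassoc_of% hσq, zero_comp, add_zero]
  have hY : τ ≫ Z.map' 1 2 ≫ c.q 1 le_rfl = Y.map' 0 1 := by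
    rw [hd1, Preadditive.comp_add, reassoc_of% hτp, reassoc_of% hτq, zero_comp, zero_add]
  have key : ∀ {T : C} (s : X.obj' 1 ⟶ T) (t : Y.obj' 0 ⟶ T),
      X.map' 0 1 ≫ s = ComposableArrows.app' φ 0 ≫ t → ∃ u : Y.obj' 1 ⟶ T,
        ComposableArrows.app' φ 1 ≫ u = s ∧ Y.map' 0 1 ≫ u = t := by
    intro T s t hst
    obtain ⟨a, ha⟩ := (hZ.2 0 one_pos T (c.p 1 le_rfl ≫ s + c.q 0 (by lia) ≫ t)).1 (by
      rw [Preadditive.comp_add, reassoc_of% hd0p, reassoc_of% hd0q, Preadditive.neg_comp,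
        Category.assoc, hst, neg_add_cancel])
    refine ⟨inv (c.q 1 le_rfl) ≫ a, ?_, ?_⟩
    · rw [← hφ, Category.assoc, Category.assoc, IsIso.hom_inv_id_assoc, ha, Preadditive.comp_add,
        reassoc_of% hσp, reassoc_of% hσq, zero_comp, add_zero]
    · rw [← hY, Category.assoc, Category.assoc, IsIso.hom_inv_id_assoc, ha, Preadditive.comp_add,
        reassoc_of% hτp, reassoc_of% hτq, zero_comp, zero_add]
  choose u hu hu' using @key
  refine IsPushout.of_isColimit' ⟨ComposableArrows.naturality' φ 0 1⟩ <| PushoutCocone.IsColimit.mk _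
    (fun s => u s.inl s.inr s.condition) (fun s => hu _ _ _) (fun s => hu' _ _ _) ?_
  intro s m h1 h2
  rw [← cancel_epi (c.q 1 le_rfl), ← cancel_epi (Z.map' 1 2 _ _), reassoc_of% hd1,
    reassoc_of% hd1]
  simp only [Preadditive.add_comp, Category.assoc]
  erw [h1, h2, hu, hu']

/-- A `1`-pullback diagram is a pullback square. -/
lemma isPullback_of_isNPullback {Y X : ComposableArrows C 1} {φ : Y ⟶ X} (h : IsNPullback φ) :
    IsPullback (ComposableArrows.app' φ 0) (Y.map' 0 1) (X.map' 0 1)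
      (ComposableArrows.app' φ 1) := by
  obtain ⟨Z, ⟨c⟩, hZ⟩ := h
  have := c.isIso_p
  have := c.isIso_q
  have hd0p := c.map_p 0 one_pos
  have hd0q := c.map_q_zero
  have hd1 := c.map_q 0 one_pos
  have hmono : Mono (Z.map' 0 1) := hZ.1
  -- the summands of `Z₁` are `Y₁` and `X₀`
  let L := biprod.lift (c.p 1 le_rfl) (c.q 0 (by lia))
  have hL : IsIso L := c.isIso_lift 0 one_pos
  have hp : c.p 1 le_rfl = L ≫ biprod.fst := (biprod.lift_fst _ _).symm
  have hq : c.q 0 (by lia) = L ≫ biprod.snd := (biprod.lift_snd _ _).symm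
  have hext : ∀ {T : C} (a b : T ⟶ Z.obj' 1), a ≫ c.p 1 le_rfl = b ≫ c.p 1 le_rfl →
      a ≫ c.q 0 (by lia) = b ≫ c.q 0 (by lia) → a = b := by
    intro T a b h1 h2
    rw [← cancel_mono L]
    ext
    · simpa [hp] using h1
    · simpa [hq] using h2
  have key : ∀ {T : C} (s : T ⟶ X.obj' 0) (t : T ⟶ Y.obj' 1),
      s ≫ X.map' 0 1 = t ≫ ComposableArrows.app' φ 1 → ∃ u : T ⟶ Y.obj' 0,
        u ≫ ComposableArrows.app' φ 0 = s ∧ u ≫ Y.map' 0 1 = t := by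
    intro T s t hst
    let r : T ⟶ Z.obj' 1 := biprod.lift (-t) s ≫ inv L
    have hrp : r ≫ c.p 1 le_rfl = -t := by simp [r, hp]
    have hrq : r ≫ c.q 0 (by lia) = s := by simp [r, hq]
    obtain ⟨a, ha⟩ := (hZ.2 0 one_pos T r).1 (by
      rw [← cancel_mono (c.q 1 le_rfl), Category.assoc, hd1, Preadditive.comp_add,
        reassoc_of% hrp, reassoc_of% hrq, zero_comp, Preadditive.neg_comp, hst, neg_add_cancel])
    refine ⟨a ≫ c.p 0 (by lia), ?_, ?_⟩
    · rw [Category.assoc, ← hd0q, reassoc_of% ha, hrq]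
    · rw [Category.assoc, ← neg_inj, ← Preadditive.comp_neg, ← hd0p, reassoc_of% ha, hrp]
  choose u hu hu' using @key
  refine IsPullback.of_isLimit' ⟨(ComposableArrows.naturality' φ 0 1).symm⟩ <|
    PullbackCone.IsLimit.mk _
    (fun s => u s.fst s.snd s.condition) (fun s => hu _ _ _) (fun s => hu' _ _ _) ?_
  intro s m h1 h2
  rw [← cancel_mono (inv (c.p 0 _)), ← cancel_mono (Z.map' 0 1 _ _)]
  apply hext
  · simp only [Category.assoc, hd0p, Preadditive.comp_neg, IsIso.inv_hom_id_assoc]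
    erw [h2, hu']
  · simp only [Category.assoc, hd0q, IsIso.inv_hom_id_assoc]
    erw [h1, hu]

lemma isConflationClass_one [HasZeroObject C] (h : IsNExactStructure 𝒳) :
    IsConflationClass (nExactTerms 𝒳) := by
  rw [← h.exactTerms_shortComplexes]
  refine isConflationClass_exactTerms_of (fun S hS => ?_) (fun S hS => ?_) ?_ ?_ ?_ ?_
  · have hk := (h.isNExactSeq _ hS).1
    have : Mono S.f := hk.1
    refine ⟨KernelFork.IsLimit.ofι' S.f S.zero fun {T} g hg => ?_⟩
    have := (hk.2 0 one_pos T g).1 hg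
    exact ⟨this.choose, this.choose_spec⟩
  · have hk := (h.isNExactSeq _ hS).2
    have : Epi S.g := hk.1
    refine ⟨CokernelCofork.IsColimit.ofπ' S.g S.zero fun {T} g hg => ?_⟩
    have := (hk.2 0 one_pos T g).1 hg
    exact ⟨this.choose, this.choose_spec⟩
  · rintro S S' hS ⟨e⟩
    exact h.mem_of_iso hS (ComposableArrows.isoMk₂ (ShortComplex.π₁.mapIso e)
      (ShortComplex.π₂.mapIso e) (ShortComplex.π₃.mapIso e) e.hom.comm₁₂.symm e.hom.comm₂₃.symm)
  · refine ⟨ShortComplex.mk (0 : (0 : C) ⟶ 0) (0 : (0 : C) ⟶ 0) comp_zero, h.zero_mem _ ?_,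
      isZero_zero C, isZero_zero C, isZero_zero C⟩
    intro i
    fin_cases i <;> exact isZero_zero C
  · intro A B A' i f hi
    obtain ⟨D, p, w, hS⟩ := hi
    obtain ⟨Y, φ, e, hφ, hpo, hmono⟩ := h.exists_pushout _ hS f
    have h1 := isPushout_of_isNPushout hpo
    refine ⟨Y.obj' 1, ComposableArrows.app' φ 1, e.inv ≫ Y.map' 0 1, ?_, ?_⟩
    · exact h1.of_iso (Iso.refl _) (Iso.refl _) e (Iso.refl _)
        ((Category.comp_id _).trans (Category.id_comp _).symm) (hφ.trans (Category.id_comp _).symm)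
        ((Category.comp_id _).trans (Category.id_comp _).symm)
        ((Category.comp_id _).trans (e.hom_inv_id_assoc _).symm)
    · rw [isAdmissibleMono_iff h]
      obtain ⟨X, hX, ⟨a⟩⟩ := hmono one_pos
      exact ⟨X, hX, ⟨a ≪≫ Arrow.isoMk e (Iso.refl _) (by simp)⟩⟩
  · intro B D D' p g hp
    obtain ⟨A, i, w, hS⟩ := hp
    obtain ⟨Y, φ, e, hφ, hpb, hepi⟩ := h.exists_pullback _ hS g
    have h1 := isPullback_of_isNPullback hpb
    refine ⟨Y.obj' 0, ComposableArrows.app' φ 0, Y.map' 0 1 ≫ e.inv, ?_, ?_⟩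
    · refine h1.of_iso (Iso.refl _) (Iso.refl _) e.symm (Iso.refl _)
        ((Category.comp_id _).trans (Category.id_comp _).symm) (Category.id_comp _).symm
        ((Category.comp_id _).trans (Category.id_comp _).symm) ?_
      rw [← hφ]
      exact (Category.comp_id _).trans (e.inv_hom_id_assoc _).symm
    · rw [isAdmissibleEpi_iff h]
      obtain ⟨X, hX, ⟨a⟩⟩ := hepi 0 rfl
      exact ⟨X, hX, ⟨a ≪≫ Arrow.isoMk (Iso.refl _) e.symm (by simp)⟩⟩

end One

lemma isConflationClass [HasZeroObject C] (h : IsNExactStructure 𝒳) (hn : 0 < n) :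
    IsConflationClass (nExactTerms 𝒳) := by
  obtain rfl | hn : n = 1 ∨ 2 ≤ n := by lia
  · exact h.isConflationClass_one
  · refine ⟨⟨_, ⟨(Functor.const _).obj 0, h.zero_mem _ fun _ => isZero_zero C, rfl⟩,
      fun _ => isZero_zero C⟩, h.iso_mem_nExactTerms, ?_⟩
    rintro _ ⟨X, hX, rfl⟩ W i hi
    obtain ⟨Y, hY⟩ := exists_isContractibleSeq (n + 1) W i (by lia)
    exact ⟨_, ⟨_, h.biprod_mem hn hX hY, rfl⟩, hY.nonempty_biprod_iso⟩

end IsNExactStructure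

end NExact

/-! ### `(n + 2)`-angulated categories -/

section Angulated

variable {C : Type u} [Category.{v} C] {n : ℕ}

namespace AngleSeq

variable {T : C ⥤ C}

lemma hom_ext {X Y : AngleSeq T n} {f g : X ⟶ Y} (h : Hom.seq f = Hom.seq g) : f = g :=
  Hom.ext h

lemma comp_map_inv {A A' B B' : C} (a : A ≅ A') (b : B ≅ B') {x : B ⟶ T.obj A}
    {y : B' ⟶ T.obj A'} (w : x ≫ T.map a.hom = b.hom ≫ y) : y ≫ T.map a.inv = b.inv ≫ x := by
  rw [Iso.eq_inv_comp, ← reassoc_of% w, ← T.map_comp, a.hom_inv_id, T.map_id, Category.comp_id]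

/-- An isomorphism of sequences compatible with the last morphisms. -/
def isoMk {X Y : AngleSeq T n} (e : X.seq ≅ Y.seq)
    (w : X.δ ≫ T.map (e.hom.app 0) = e.hom.app (Fin.last (n + 1)) ≫ Y.δ) : X ≅ Y where
  hom := ⟨e.hom, w⟩
  inv := ⟨e.inv, comp_map_inv (e.app 0) (e.app (Fin.last (n + 1))) w⟩
  hom_inv_id := hom_ext e.hom_inv_id
  inv_hom_id := hom_ext e.inv_hom_id

section DirectSum

variable [Preadditive C] [HasBinaryBiproducts C] (X Y : AngleSeq T n)

/-- The termwise direct sum of two `(n + 2)`-`T`-sequences. -/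
def directSum : AngleSeq T n where
  seq := X.seq ⊞ Y.seq
  δ := (biprod.fst : X.seq ⊞ Y.seq ⟶ X.seq).app (Fin.last (n + 1)) ≫ X.δ ≫
      T.map ((biprod.inl : X.seq ⟶ X.seq ⊞ Y.seq).app 0) +
    (biprod.snd : X.seq ⊞ Y.seq ⟶ Y.seq).app (Fin.last (n + 1)) ≫ Y.δ ≫
      T.map ((biprod.inr : Y.seq ⟶ X.seq ⊞ Y.seq).app 0)

/-- The inclusion of the first summand. -/
def directSumInl : X ⟶ directSum X Y where
  seq := biprod.inl
  comm := by
    -- stated for arbitrary objects: the terms of the direct sum agree with those of `X.seq ⊞ Y.seq`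
    -- only after unfolding, which `exact` does and `rw` does not
    have h {A B D A' B' D' : C} (i : A ⟶ D) (p : D ⟶ A) (q : D ⟶ B) (i' : A' ⟶ D') (j' : B' ⟶ D')
        (x : A ⟶ T.obj A') (y : B ⟶ T.obj B') (h₁ : i ≫ p = 𝟙 A) (h₂ : i ≫ q = 0) :
        x ≫ T.map i' = i ≫ (p ≫ x ≫ T.map i' + q ≫ y ≫ T.map j') := by
      rw [Preadditive.comp_add, reassoc_of% h₁, reassoc_of% h₂, zero_comp, add_zero]
    exact h _ _ _ _ _ _ _ (inl_fst_app X.seq Y.seq (Fin.last (n + 1)))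
      (inl_snd_app X.seq Y.seq (Fin.last (n + 1)))

lemma isDirectSum_directSum [T.PreservesZeroMorphisms] : X.IsDirectSum Y (directSum X Y) := by
  refine ⟨directSumInl X Y, ⟨biprod.inr, ?_⟩, ⟨biprod.fst, ?_⟩, ⟨biprod.snd, ?_⟩,
    hom_ext biprod.inl_fst, hom_ext biprod.inr_snd, biprod.total⟩
  · have h {A B D A' B' D' : C} (j : B ⟶ D) (p : D ⟶ A) (q : D ⟶ B) (i' : A' ⟶ D') (j' : B' ⟶ D')
        (x : A ⟶ T.obj A') (y : B ⟶ T.obj B') (h₁ : j ≫ p = 0) (h₂ : j ≫ q = 𝟙 B) :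
        y ≫ T.map j' = j ≫ (p ≫ x ≫ T.map i' + q ≫ y ≫ T.map j') := by
      rw [Preadditive.comp_add, reassoc_of% h₁, reassoc_of% h₂, zero_comp, zero_add]
    exact h _ _ _ _ _ _ _ (inr_fst_app X.seq Y.seq (Fin.last (n + 1)))
      (inr_snd_app X.seq Y.seq (Fin.last (n + 1)))
  · have h {A B D A' B' D' : C} (p : D ⟶ A) (q : D ⟶ B) (i' : A' ⟶ D') (j' : B' ⟶ D')
        (p' : D' ⟶ A') (x : A ⟶ T.obj A') (y : B ⟶ T.obj B') (h₁ : i' ≫ p' = 𝟙 A')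
        (h₂ : j' ≫ p' = 0) : (p ≫ x ≫ T.map i' + q ≫ y ≫ T.map j') ≫ T.map p' = p ≫ x := by
      simp [← T.map_comp, h₁, h₂]
    exact h _ _ _ _ _ _ _ (inl_fst_app X.seq Y.seq 0) (inr_fst_app X.seq Y.seq 0)
  · have h {A B D A' B' D' : C} (p : D ⟶ A) (q : D ⟶ B) (i' : A' ⟶ D') (j' : B' ⟶ D')
        (q' : D' ⟶ B') (x : A ⟶ T.obj A') (y : B ⟶ T.obj B') (h₁ : i' ≫ q' = 0)
        (h₂ : j' ≫ q' = 𝟙 B') : (p ≫ x ≫ T.map i' + q ≫ y ≫ T.map j') ≫ T.map q' = q ≫ y := by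
      simp [← T.map_comp, h₁, h₂]
    exact h _ _ _ _ _ _ _ (inl_snd_app X.seq Y.seq 0) (inr_snd_app X.seq Y.seq 0)

end DirectSum

end AngleSeq

namespace IsAngulation

variable [Preadditive C] [HasZeroObject C] [HasBinaryBiproducts C] {T : C ≌ C}
  {𝒩 : Set (AngleSeq T.functor n)}

/-- All contractible sequences are angles, by rotating the trivial ones. -/
lemma contractible_mem (h : IsAngulation T n 𝒩) (W : C) (k : ℕ) (hk : k < n + 1)
    (X : AngleSeq T.functor n) (hX : IsContractibleSeq X.seq W k hk) : X ∈ 𝒩 := by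
  induction k generalizing X with
  | zero =>
    exact h.trivial_mem X hX.isIso fun i hi hi' => hX.isZero _ (by simp; lia) (by simp; lia)
  | succ k ih =>
    obtain ⟨Y, hY⟩ := exists_isContractibleSeq (n + 1) W k (by lia)
    have := hX.isIso
    have := hY.isIso
    obtain ⟨a⟩ : Nonempty (Y.obj' k ≅ X.seq.obj' (k + 1)) :=
      ⟨hY.iso.some ≪≫ hX.iso.some.symm⟩
    have hzX : ∀ i (hi : i ≤ n + 1), i ≠ k + 1 → i ≠ k + 2 → IsZero (X.seq.obj' i) :=
      fun i hi h1 h2 => hX.isZero _ h1 h2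
    have hzY : ∀ i (hi : i ≤ n + 1), i ≠ k → i ≠ k + 1 → IsZero (Y.obj' i hi) :=
      fun i hi h1 h2 => hY.isZero _ h1 h2
    have he : ∀ i (hi : i ≤ n), ∃ e : Y.obj' i (by lia) ≅ X.seq.obj' (i + 1), ∀ hki : k ≤ i,
        Y.map' k i ≫ e.hom = a.hom ≫ X.seq.map' (k + 1) (i + 1) := by
      intro i hi
      by_cases h1 : i = k
      · subst h1
        refine ⟨a, fun _ => ?_⟩
        rw [Y.map'_self _ _, X.seq.map'_self _ _, Category.id_comp, Category.comp_id]
      · by_cases h2 : i = k + 1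
        · subst h2
          refine ⟨(asIso (Y.map' k (k + 1) _ _)).symm ≪≫ a ≪≫
            asIso (X.seq.map' (k + 1) (k + 2) _ _), fun _ => ?_⟩
          simp
        · have hz := hzX (i + 1) (by lia) (by lia) (by lia)
          exact ⟨(hzY i (by lia) h1 h2).iso hz, fun _ => hz.eq_of_tgt _ _⟩
    choose e he using he
    have hX0 := hzX 0 (by lia) (by lia) (by lia)
    have hTX0 : IsZero (T.functor.obj (X.seq.obj' 0)) := T.functor.map_isZero hX0
    have hYn := hzY (n + 1) le_rfl (by lia) (by lia)
    refine (h.rotation_mem_iff X ⟨Y, 0⟩ ⟨⟨e, hYn.iso hTX0, fun i hi => ?_,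
      hTX0.eq_of_tgt _ _, hYn.eq_of_src _ _⟩⟩).2 (ih _ ⟨Y, 0⟩ hY)
    by_cases h1 : i = k
    · subst h1
      have h0 := he i (by lia) le_rfl
      rw [Y.map'_self _ _, X.seq.map'_self _ _, Category.id_comp, Category.comp_id] at h0
      rw [he (i + 1) (by lia) (by lia), h0]
    · by_cases h2 : i = k + 1
      · exact (hzX (i + 2) (by lia) (by lia) (by lia)).eq_of_tgt _ _
      · exact (hzY i (by lia) h1 h2).eq_of_src _ _

lemma directSum_mem (h : IsAngulation T n 𝒩) {X Y : AngleSeq T.functor n} (hX : X ∈ 𝒩)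
    (hY : Y ∈ 𝒩) : AngleSeq.directSum X Y ∈ 𝒩 :=
  (h.directSum_mem_iff X Y _ (AngleSeq.isDirectSum_directSum X Y)).2 ⟨hX, hY⟩

lemma exists_contractible_mem (h : IsAngulation T n 𝒩) (W : C) (k : ℕ)
    (hk : k < n + 1) : ∃ X ∈ 𝒩, IsContractibleSeq X.seq W k hk := by
  obtain ⟨X, hX⟩ := exists_isContractibleSeq (n + 1) W k hk
  exact ⟨⟨X, 0⟩, h.contractible_mem W k hk _ hX, hX⟩

lemma isConflationClass (h : IsAngulation T n 𝒩) :
    IsConflationClass (angleTerms 𝒩) where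
  zero_mem := by
    obtain ⟨X, hX, hX'⟩ := h.exists_contractible_mem 0 0 (by lia)
    refine ⟨_, ⟨X, hX, rfl⟩, fun i => ?_⟩
    by_cases hi : (i : ℕ) = 0 ∨ (i : ℕ) = 0 + 1
    · exact (isZero_zero C).of_iso (hX'.nonempty_iso i hi).some
    · exact hX'.isZero i (by tauto) (by tauto)
  iso_mem := by
    rintro _ ⟨X, hX, rfl⟩ Y e
    let e' := fun i => (e i).some
    let Z : AngleSeq T.functor n :=
      { seq := X.seq.copyObj Y e'
        δ := (e' (Fin.last (n + 1))).inv ≫ X.δ ≫ T.functor.map (e' 0).hom }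
    refine ⟨Z, h.iso_mem X Z hX ⟨AngleSeq.isoMk (X.seq.isoCopyObj Y e') ?_⟩, rfl⟩
    simp only [Functor.isoCopyObj_hom_app, Z]
    exact ((e' (Fin.last (n + 1))).hom_inv_id_assoc _).symm
  add_mem := by
    rintro _ ⟨X, hX, rfl⟩ W i hi
    obtain ⟨Y, hY, hY'⟩ := h.exists_contractible_mem W i (by lia)
    exact ⟨_, ⟨_, h.directSum_mem hX hY, rfl⟩, hY'.nonempty_biprod_iso⟩

/-- `A ⟶ 0 ⟶ ⋯ ⟶ 0 ⟶ T A` is an angle: the rotation of the trivial angle on `A`. -/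
lemma shift_mem (h : IsAngulation T n 𝒩) (hn : 0 < n) (A : C) :
    (fun j : Fin (n + 2) => if (j : ℕ) = 0 then A else if (j : ℕ) = n + 1 then T.functor.obj A
      else 0) ∈ angleTerms 𝒩 := by
  obtain ⟨X, hX, hX'⟩ := h.exists_contractible_mem A 0 (by lia)
  obtain ⟨a⟩ := hX'.iso
  have := hX'.isIso
  have hz : ∀ i (hi : i ≤ n + 1), 2 ≤ i → IsZero (X.seq.obj' i) :=
    fun i hi h1 => hX'.isZero _ (by simp; lia) (by simp; lia)
  let obj : Fin (n + 2) → C := fun j => if (j : ℕ) = 0 then A else if (j : ℕ) = n + 1 then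
    T.functor.obj A else 0
  have hobj : ∀ i (hi : i ≤ n + 1), 0 < i → i ≤ n → IsZero (obj ⟨i, by lia⟩) := by
    intro i hi h1 h2
    have h3 : obj ⟨i, by lia⟩ = 0 := by
      simp only [obj]
      rw [if_neg (by lia), if_neg (by lia)]
    rw [h3]
    exact isZero_zero C
  let Y := ComposableArrows.mkOfObjOfMapSucc obj fun _ => 0
  have he : ∀ i (hi : i ≤ n), Nonempty (Y.obj' i ≅ X.seq.obj' (i + 1)) := by
    intro i hi
    rcases i with _ | i
    · exact ⟨a.symm ≪≫ asIso (X.seq.map' 0 1 _ _)⟩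
    · exact ⟨(hobj (i + 1) (by lia) (by lia) hi).iso (hz (i + 2) (by lia) (by lia))⟩
  let e := fun i hi => (he i hi).some
  have hlast : obj (Fin.last (n + 1)) = T.functor.obj A := by simp [obj]
  let e' : Y.obj' (n + 1) ≅ T.functor.obj (X.seq.obj' 0) :=
    eqToIso hlast ≪≫ T.functor.mapIso a.symm
  refine ⟨⟨Y, (-1 : ℤ) ^ n • (e'.hom ≫ T.functor.map (X.seq.map' 0 1)) ≫
    T.functor.map (e 0 (by lia)).inv⟩, ?_, rfl⟩
  refine (h.rotation_mem_iff X _ ⟨⟨e, e', fun i hi =>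
    (hz (i + 2) (by lia) (by lia)).eq_of_tgt _ _, ?_, ?_⟩⟩).1 hX
  · exact (hobj n (by lia) hn le_rfl).eq_of_src _ _
  · simp only [Preadditive.zsmul_comp, Category.assoc, ← Functor.map_comp, Iso.inv_hom_id,
      Category.comp_id]

/-- The angles `T⁻¹ A ⟶ 0 ⟶ ⋯ ⟶ 0 ⟶ A` show that the zero objects form an `n`-generator. -/
lemma isNGenerator_isZero (h : IsAngulation T n 𝒩) (hn : 0 < n) :
    IsNGenerator (angleTerms 𝒩) (fun A : C => IsZero A) := by
  intro A
  refine ⟨_, h.shift_mem hn (T.inverse.obj A), ?_, fun i h0 h1 => ?_⟩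
  · simpa using ⟨T.counitIso.app A⟩
  · have h0' : ¬ (i : ℕ) = 0 := fun hi => h0 (Fin.ext hi)
    have h1' : ¬ (i : ℕ) = n + 1 := fun hi => h1 (Fin.ext hi)
    simp only [h0', h1', if_false]
    exact isZero_zero C

end IsAngulation

end Angulated

/-! ### Functors and `(n + 2)`-`T`-sequences -/

section Functors

namespace AngleSeq

variable {C : Type*} [Category* C] {D : Type*} [Category* D] {n : ℕ} {T : C ⥤ C} {T' : D ⥤ D}
  (F : D ⥤ C) (η : T' ⋙ F ≅ F ⋙ T)

/-- The functoriality of `AngleSeq.map`. -/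
def mapHom {X Y : AngleSeq T' n} (f : X ⟶ Y) : X.map F η ⟶ Y.map F η where
  seq := Functor.whiskerRight (Hom.seq f) F
  comm := by
    -- stated for arbitrary objects, as the terms of `X.map F η` are images under `F` only after
    -- unfolding; the same device is used below
    have h {A B A' B' : D} (x : A ⟶ T'.obj B) (y : A' ⟶ T'.obj B') (a : A ⟶ A') (b : B ⟶ B')
        (w : x ≫ T'.map b = a ≫ y) : (F.map x ≫ η.hom.app B) ≫ T.map (F.map b) =
          F.map a ≫ F.map y ≫ η.hom.app B' := by
      have := η.hom.naturality b
      dsimp at this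
      rw [Category.assoc, ← this, ← F.map_comp_assoc, w, F.map_comp_assoc]
    exact h _ _ _ _ (Hom.comm f)

lemma mapHom_id (X : AngleSeq T' n) : mapHom F η (𝟙 X) = 𝟙 _ :=
  hom_ext (Functor.whiskerRight_id' _)

lemma mapHom_comp {X Y Z : AngleSeq T' n} (f : X ⟶ Y) (g : Y ⟶ Z) :
    mapHom F η (f ≫ g) = mapHom F η f ≫ mapHom F η g :=
  hom_ext (Functor.whiskerRight_comp _ _ _)

/-- `AngleSeq.map` preserves isomorphisms. -/
def mapIso {X Y : AngleSeq T' n} (e : X ≅ Y) : X.map F η ≅ Y.map F η where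
  hom := mapHom F η e.hom
  inv := mapHom F η e.inv
  hom_inv_id := by rw [← mapHom_comp, e.hom_inv_id, mapHom_id]
  inv_hom_id := by rw [← mapHom_comp, e.inv_hom_id, mapHom_id]

lemma exists_mapHom_eq [F.Full] [F.Faithful] {X Y : AngleSeq T' n} (ψ : X.map F η ⟶ Y.map F η) :
    ∃ φ : X ⟶ Y, mapHom F η φ = ψ := by
  let ψ' : X.seq ⋙ F ⟶ Y.seq ⋙ F := Hom.seq ψ
  let hF := (Functor.FullyFaithful.ofFullyFaithful F).whiskeringRight (Fin (n + 2))
  obtain ⟨α, hα⟩ : ∃ α : X.seq ⟶ Y.seq, Functor.whiskerRight α F = ψ' :=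
    ⟨hF.preimage ψ', hF.map_preimage ψ'⟩
  have h {A B A' B' : D} (x : A ⟶ T'.obj B) (y : A' ⟶ T'.obj B') (a : A ⟶ A') (b : B ⟶ B')
      (w : (F.map x ≫ η.hom.app B) ≫ T.map (F.map b) = F.map a ≫ F.map y ≫ η.hom.app B') :
      x ≫ T'.map b = a ≫ y := by
    have := η.hom.naturality b
    dsimp at this
    rw [Category.assoc, ← this, ← F.map_comp_assoc, ← F.map_comp_assoc, cancel_mono] at w
    exact F.map_injective w
  refine ⟨⟨α, h _ _ _ _ ?_⟩, hom_ext hα⟩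
  change (F.map X.δ ≫ η.hom.app _) ≫ T.map ((Functor.whiskerRight α F).app 0) =
    (Functor.whiskerRight α F).app (Fin.last (n + 1)) ≫ F.map Y.δ ≫ η.hom.app _
  rw [hα]
  exact Hom.comm ψ

variable [Preadditive C] [Preadditive D] [F.Additive]

lemma IsDirectSum.map {X Y Z : AngleSeq T' n} (h : X.IsDirectSum Y Z) :
    (X.map F η).IsDirectSum (Y.map F η) (Z.map F η) := by
  obtain ⟨inl, inr, fst, snd, h1, h2, h3⟩ := h
  refine ⟨mapHom F η inl, mapHom F η inr, mapHom F η fst, mapHom F η snd, ?_, ?_, ?_⟩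
  · rw [← mapHom_comp, h1, mapHom_id]
  · rw [← mapHom_comp, h2, mapHom_id]
  · refine NatTrans.ext (funext fun i => ?_)
    have := congrArg F.map (congrArg (fun α => α.app i) h3)
    dsimp at this
    rw [F.map_add, F.map_comp, F.map_comp, F.map_id] at this
    exact this

/-- `AngleSeq.map` preserves rotations. -/
def LeftRotation.map {X Y : AngleSeq T' n} (r : X.LeftRotation Y) :
    (X.map F η).LeftRotation (Y.map F η) where
  e i hi := F.mapIso (r.e i hi)
  e' := F.mapIso r.e' ≪≫ η.app _
  map_e i hi := by
    have h := congrArg F.map (r.map_e i hi)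
    rw [F.map_comp, F.map_comp] at h
    exact h
  map_e' := by
    have h {A B A' B' : D} (y : A ⟶ B) (x : A' ⟶ T'.obj B') (a : A ⟶ A') (b : B ⟶ T'.obj B')
        (w : y ≫ b = a ≫ x) : F.map y ≫ F.map b ≫ η.hom.app B' =
          F.map a ≫ F.map x ≫ η.hom.app B' := by
      rw [← F.map_comp_assoc, w, F.map_comp_assoc]
    exact h _ _ _ _ r.map_e'
  δ_e := by
    have h {A B A' B' : D} (y : A ⟶ T'.obj B) (x : A ⟶ T'.obj A') (a : B ⟶ B') (b : A' ⟶ B')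
        (w : y ≫ T'.map a = (-1 : ℤ) ^ n • (x ≫ T'.map b)) :
        (F.map y ≫ η.hom.app B) ≫ T.map (F.map a) =
          (-1 : ℤ) ^ n • ((F.map x ≫ η.hom.app A') ≫ T.map (F.map b)) := by
      have ha := η.hom.naturality a
      have hb := η.hom.naturality b
      dsimp at ha hb
      rw [Category.assoc, Category.assoc, ← ha, ← hb, ← F.map_comp_assoc, w, F.map_zsmul,
        Preadditive.zsmul_comp, F.map_comp_assoc]
    exact h _ _ _ _ r.δ_e

section MappingCone

variable [HasBinaryBiproducts C] [HasBinaryBiproducts D]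

/-- A fully faithful additive functor reflects mapping cones: all the data have unique preimages. -/
lemma MappingCone.nonempty_of_map [F.Full] [F.Faithful] {X Y Z : AngleSeq T' n} {φ : X ⟶ Y}
    (c : MappingCone (mapHom F η φ) (Z.map F η)) : Nonempty (MappingCone φ Z) := by
  have hlift {A B B' : D} {B₀ : C} (p : A ⟶ B) (q : A ⟶ B') (e : F.obj B ≅ B₀)
      {P : F.obj A ⟶ B₀} {Q : F.obj A ⟶ F.obj B'} (hp : F.map p ≫ e.hom = P) (hq : F.map q = Q)
      (h : IsIso (biprod.lift P Q)) : IsIso (biprod.lift p q) := by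
    subst hp hq
    obtain ⟨k, h1, h2⟩ := h
    obtain ⟨i, hi⟩ := F.map_surjective (e.hom ≫ biprod.inl ≫ k)
    obtain ⟨j, hj⟩ := F.map_surjective (biprod.inr ≫ k)
    refine ⟨biprod.desc i j, ?_, ?_⟩
    · rw [biprod.lift_desc]
      apply F.map_injective
      rw [F.map_add, F.map_comp, F.map_comp, F.map_id, hi, hj, ← h1, biprod.lift_eq]
      simp
    · have h3 := congrArg (· ≫ biprod.fst ≫ e.inv) h2
      have h4 := congrArg (· ≫ biprod.snd) h2
      simp only [Category.assoc, biprod.lift_fst_assoc, biprod.lift_snd, Category.id_comp,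
        Iso.hom_inv_id, Category.comp_id] at h3 h4
      ext <;> apply F.map_injective <;> simp [hi, hj, h3, h4]
  have hp : ∀ i (hi : i ≤ n), ∃ p : Z.seq.obj' i ⟶ X.seq.obj' (i + 1), F.map p = c.p i hi :=
    fun i hi => F.map_surjective (c.p i hi)
  have hq : ∀ i (hi : i ≤ n + 1), ∃ q : Z.seq.obj' i ⟶ Y.seq.obj' i, F.map q = c.q i hi :=
    fun i hi => F.map_surjective (c.q i hi)
  choose p hp using hp
  choose q hq using hq
  have hp0 {A B : D} (g : F.obj A ⟶ T.obj (F.obj B)) :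
      ∃ p' : A ⟶ T'.obj B, F.map p' ≫ η.hom.app B = g := by
    obtain ⟨p', hp'⟩ := F.map_surjective (g ≫ η.inv.app _)
    exact ⟨p', by
      rw [hp', Category.assoc, Iso.inv_hom_id_app]
      exact Category.comp_id g⟩
  obtain ⟨p', hp'⟩ : ∃ p' : Z.seq.obj' (n + 1) ⟶ T'.obj (X.seq.obj' 0),
      F.map p' ≫ η.hom.app _ = c.p' := hp0 _
  refine ⟨⟨p, p', q, fun i hi => hlift _ _ (Iso.refl _)
    ((Category.comp_id _).trans (hp i hi)) (hq i _) (c.isIso_lift i hi),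
    hlift _ _ (η.app _) hp' (hq _ _) c.isIso_lift', ?_, ?_,
    ?_, ?_, ?_⟩⟩
  · intro i hi
    have h {A B A' B' : D} (z : A ⟶ B) (x : A' ⟶ B') (p₀ : A ⟶ A') (p₁ : B ⟶ B')
        {P₀ : F.obj A ⟶ F.obj A'} {P₁ : F.obj B ⟶ F.obj B'} (h₀ : F.map p₀ = P₀)
        (h₁ : F.map p₁ = P₁) (w : F.map z ≫ P₁ = -(P₀ ≫ F.map x)) : z ≫ p₁ = -(p₀ ≫ x) := by
      subst h₀ h₁
      apply F.map_injective
      simpa using w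
    exact h _ _ _ _ (hp _ _) (hp _ _) (c.map_p i hi)
  · have h {A B A' B' : D} (z : A ⟶ B) (x : A' ⟶ T'.obj B') (p₀ : A ⟶ A') (p₁ : B ⟶ T'.obj B')
        {P₀ : F.obj A ⟶ F.obj A'} {P₁ : F.obj B ⟶ T.obj (F.obj B')} (h₀ : F.map p₀ = P₀)
        (h₁ : F.map p₁ ≫ η.hom.app B' = P₁)
        (w : F.map z ≫ P₁ = -(P₀ ≫ F.map x ≫ η.hom.app B')) : z ≫ p₁ = -(p₀ ≫ x) := by
      subst h₀ h₁
      apply F.map_injective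
      rw [← cancel_mono (η.hom.app B')]
      simpa using w
    exact h _ _ _ _ (hp _ _) hp' c.map_p'
  · intro i hi
    have h {A B A' B' D₀ : D} (z : A ⟶ B) (p₀ : A ⟶ A') (f : A' ⟶ B') (q₀ : A ⟶ D₀)
        (y : D₀ ⟶ B') (q₁ : B ⟶ B') {P₀ : F.obj A ⟶ F.obj A'} {Q₀ : F.obj A ⟶ F.obj D₀}
        {Q₁ : F.obj B ⟶ F.obj B'} (h₀ : F.map p₀ = P₀) (h₁ : F.map q₀ = Q₀)
        (h₂ : F.map q₁ = Q₁) (w : F.map z ≫ Q₁ = P₀ ≫ F.map f + Q₀ ≫ F.map y) :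
        z ≫ q₁ = p₀ ≫ f + q₀ ≫ y := by
      subst h₀ h₁ h₂
      apply F.map_injective
      simpa using w
    exact h _ _ _ _ _ _ (hp _ _) (hq _ _) (hq _ _) (c.map_q i hi)
  · have h {A B A' B' : D} (z : A ⟶ T'.obj B) (p₀ : B ⟶ B') (p₁ : A ⟶ T'.obj A') (x : A' ⟶ B')
        {P₀ : F.obj B ⟶ F.obj B'} {P₁ : F.obj A ⟶ T.obj (F.obj A')} (h₀ : F.map p₀ = P₀)
        (h₁ : F.map p₁ ≫ η.hom.app A' = P₁)
        (w : (F.map z ≫ η.hom.app B) ≫ T.map P₀ = -(P₁ ≫ T.map (F.map x))) :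
        z ≫ T'.map p₀ = -(p₁ ≫ T'.map x) := by
      subst h₀ h₁
      have h2 := η.hom.naturality p₀
      have h3 := η.hom.naturality x
      dsimp at h2 h3
      rw [Category.assoc, Category.assoc, ← h2, ← h3] at w
      apply F.map_injective
      rw [← cancel_mono (η.hom.app B')]
      simpa using w
    exact h _ _ _ _ (hp _ _) hp' c.δ_p
  · have h {A B A' B' B₁ : D} (z : A ⟶ T'.obj B) (q₀ : B ⟶ B') (p₁ : A ⟶ T'.obj A')
        (f : A' ⟶ B') (q₁ : A ⟶ B₁) (y : B₁ ⟶ T'.obj B') {Q₀ : F.obj B ⟶ F.obj B'}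
        {P₁ : F.obj A ⟶ T.obj (F.obj A')} {Q₁ : F.obj A ⟶ F.obj B₁} (h₀ : F.map q₀ = Q₀)
        (h₁ : F.map p₁ ≫ η.hom.app A' = P₁) (h₂ : F.map q₁ = Q₁)
        (w : (F.map z ≫ η.hom.app B) ≫ T.map Q₀ =
          P₁ ≫ T.map (F.map f) + (Q₁ ≫ F.map y ≫ η.hom.app B' : F.obj A ⟶ T.obj (F.obj B'))) :
        z ≫ T'.map q₀ = p₁ ≫ T'.map f + q₁ ≫ y := by
      subst h₀ h₁ h₂
      have h2 := η.hom.naturality q₀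
      have h3 := η.hom.naturality f
      dsimp at h2 h3
      rw [Category.assoc, Category.assoc, ← h2, ← h3] at w
      apply F.map_injective
      rw [← cancel_mono (η.hom.app B')]
      simpa using w
    exact h _ _ _ _ _ _ (hq _ _) hp' (hq _ _) c.δ_q

end MappingCone

end AngleSeq

end Functors

/-! ### Dense complete subcategories of `(n + 2)`-angulated categories -/

section DenseAngulatedSubcategory

variable {C : Type u} [Category.{v} C] [Preadditive C] {n : ℕ}

lemma hasBinaryBiproducts_fullSubcategory [HasBinaryBiproducts C] {S : ObjectProperty C}
    (h : ∀ A B, S A → S B → S (A ⊞ B)) : HasBinaryBiproducts S.FullSubcategory where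
  has_binary_biproduct A B := HasBinaryBiproduct.mk
    { bicone :=
        { pt := ⟨A.obj ⊞ B.obj, h _ _ A.property B.property⟩
          fst := ObjectProperty.homMk biprod.fst
          snd := ObjectProperty.homMk biprod.snd
          inl := ObjectProperty.homMk biprod.inl
          inr := ObjectProperty.homMk biprod.inr
          inl_fst := ObjectProperty.hom_ext _ biprod.inl_fst
          inl_snd := ObjectProperty.hom_ext _ biprod.inl_snd
          inr_fst := ObjectProperty.hom_ext _ biprod.inr_fst
          inr_snd := ObjectProperty.hom_ext _ biprod.inr_snd }
      isBilimit := isBinaryBilimitOfTotal _ (ObjectProperty.hom_ext _ biprod.total) }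

lemma hasZeroObject_fullSubcategory [HasZeroObject C] {S : ObjectProperty C} (h : S 0) :
    HasZeroObject S.FullSubcategory := by
  refine ⟨⟨⟨0, h⟩, ?_⟩⟩
  rw [IsZero.iff_id_eq_zero]
  exact ObjectProperty.hom_ext _ ((IsZero.iff_id_eq_zero _).1 (isZero_zero C))

variable [HasBinaryBiproducts C] [HasZeroObject C] {T : C ≌ C} {𝒩 : Set (AngleSeq T.functor n)}
  {S : ObjectProperty C}

/-- Adding contractible angles moves the terms `X₂, …, Xₖ` of an angle into a dense subcategory that
contains `X₀` and `X₁`, without changing the first morphism. -/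
lemma IsAngulation.exists_prop_obj_of_le (h : IsAngulation T n 𝒩) (hd : IsDenseSubcategory S)
    [S.IsClosedUnderIsomorphisms] {X : AngleSeq T.functor n} (hX : X ∈ 𝒩)
    (h0 : S (X.seq.obj' 0)) (h1 : S (X.seq.obj' 1)) (k : ℕ) (hk : 1 ≤ k) (hkn : k ≤ n) :
    ∃ Y ∈ 𝒩, (∀ i (hi : i ≤ k), S (Y.seq.obj' i)) ∧ ∃ f : X.seq ⟶ Y.seq,
      IsIso (ComposableArrows.app' f 0) ∧ IsIso (ComposableArrows.app' f 1) := by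
  induction k, hk using Nat.le_induction with
  | base =>
    refine ⟨X, hX, fun i hi => ?_, 𝟙 _, ?_, ?_⟩
    · interval_cases i
      · exact h0
      · exact h1
    · exact inferInstanceAs (IsIso (𝟙 (X.seq.obj' 0)))
    · exact inferInstanceAs (IsIso (𝟙 (X.seq.obj' 1)))
  | succ k hk ih =>
    obtain ⟨Y, hY, hYS, f, hf0, hf1⟩ := ih (by lia)
    obtain ⟨W, B, hB, ⟨e⟩⟩ := hd (Y.seq.obj' (k + 1))
    obtain ⟨Z, hZ, hZ'⟩ := h.exists_contractible_mem W (k + 1) (by lia)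
    have hiso : ∀ i (hi : i ≤ k), IsIso (ComposableArrows.app'
        (biprod.inl : Y.seq ⟶ Y.seq ⊞ Z.seq) i) := fun i hi =>
      isIso_inl_app _ _ _ (hZ'.isZero ⟨i, by lia⟩ (by simp; lia) (by simp; lia))
    refine ⟨_, h.directSum_mem hY hZ, fun i hi => ?_, f ≫ biprod.inl, ?_, ?_⟩
    · by_cases hik : i = k + 1
      · subst hik
        obtain ⟨e'⟩ := hZ'.nonempty_iso ⟨k + 1, by lia⟩ (Or.inl rfl)
        exact S.prop_of_iso (e ≪≫ biprod.mapIso (Iso.refl _) e'.symm ≪≫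
          (biprodObjIso Y.seq Z.seq ⟨k + 1, by lia⟩).symm) hB
      · have := hiso i (by lia)
        exact S.prop_of_iso (@asIso _ _ _ _ _ this) (hYS i (by lia))
    · have := hiso 0 (by lia)
      exact IsIso.comp_isIso' hf0 this
    · have := hiso 1 (by lia)
      exact IsIso.comp_isIso' hf1 this

omit [Preadditive C] [HasBinaryBiproducts C] [HasZeroObject C] in
/-- A sequence with terms in a `T`-stable full subcategory is one of that subcategory. -/
lemma AngleSeq.exists_map_eq {T' : S.FullSubcategory ⥤ S.FullSubcategory} {T : C ⥤ C}
    (η : T' ⋙ S.ι ≅ S.ι ⋙ T) (X : AngleSeq T n) (hX : ∀ i, S (X.seq.obj i)) :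
    ∃ Y : AngleSeq T' n, X = Y.map S.ι η := by
  let δ : X.seq.obj (Fin.last (n + 1)) ⟶ T.obj (X.seq.obj 0) := X.δ
  refine ⟨⟨S.lift X.seq hX, ObjectProperty.homMk (δ ≫ η.inv.app ⟨X.seq.obj 0, hX 0⟩)⟩, ?_⟩
  have hδ : (δ ≫ η.inv.app ⟨X.seq.obj 0, hX 0⟩) ≫ η.hom.app ⟨X.seq.obj 0, hX 0⟩ = δ := by
    rw [Category.assoc, Iso.inv_hom_id_app]
    exact Category.comp_id δ
  rcases X with ⟨X, δ'⟩
  exact congrArg (AngleSeq.mk X) hδ.symm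

lemma IsAngulation.prop_shift_iff (h : IsAngulation T n 𝒩) (hn : 0 < n)
    (hS : IsCompleteSubcategory (angleTerms 𝒩) S) (h0 : S 0) (A : C) :
    S (T.functor.obj A) ↔ S A := by
  constructor
  · intro hA
    have := hS _ (h.shift_mem hn A) 0 fun i hi => by
      have hi' : ¬ (i : ℕ) = 0 := fun h => hi (Fin.ext h)
      simp only [hi', if_false]
      split_ifs
      · exact hA
      · exact h0
    simpa using this
  · intro hA
    have := hS _ (h.shift_mem hn A) (Fin.last _) fun i hi => by
      have hi' : ¬ (i : ℕ) = n + 1 := fun h => hi (Fin.ext h)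
      simp only [hi', if_false]
      split_ifs
      · exact hA
      · exact h0
    simpa using this

/-- The angles with terms in a dense complete subcategory form an angulation. -/
lemma IsAngulation.restrict (h : IsAngulation T n 𝒩) (hn : 0 < n) (hd : IsDenseSubcategory S)
    (hS : IsCompleteSubcategory (angleTerms 𝒩) S) [S.IsClosedUnderIsomorphisms]
    (hsum : ∀ A B Z, S A → S B → Nonempty (Z ≅ A ⊞ B) → S Z)
    (hT : ∀ A, S (T.functor.obj A) ↔ S A)
    [HasZeroObject S.FullSubcategory] [HasBinaryBiproducts S.FullSubcategory]
    {T' : S.FullSubcategory ≌ S.FullSubcategory}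
    (η : T'.functor ⋙ S.ι ≅ S.ι ⋙ T.functor) :
    IsAngulation T' n {X : AngleSeq T'.functor n | X.map S.ι η ∈ 𝒩} where
  iso_mem X Y hX := fun ⟨e⟩ => h.iso_mem _ _ hX ⟨AngleSeq.mapIso S.ι η e⟩
  directSum_mem_iff X Y Z hZ := h.directSum_mem_iff _ _ _ (hZ.map S.ι η)
  trivial_mem X hX hX' := h.trivial_mem _
    (inferInstanceAs (IsIso (S.ι.map (X.seq.map' 0 1 _ _)))) fun i hi hi' => S.ι.map_isZero (hX' i hi hi')
  rotation_mem_iff X Y := fun ⟨r⟩ => h.rotation_mem_iff _ _ ⟨r.map S.ι η⟩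
  exists_angle {A B} f := by
    obtain ⟨X, hX, ⟨e⟩⟩ := h.exists_angle f.hom
    let e₀ : X.seq.obj' 0 ≅ A.obj := Arrow.leftFunc.mapIso e
    let e₁ : X.seq.obj' 1 ≅ B.obj := Arrow.rightFunc.mapIso e
    have he : e₀.hom ≫ f.hom = X.seq.map' 0 1 ≫ e₁.hom := e.hom.w
    obtain ⟨Y, hY, hYS, g, hg0, hg1⟩ := h.exists_prop_obj_of_le hd hX
      (S.prop_of_iso e₀.symm A.property) (S.prop_of_iso e₁.symm B.property) n hn le_rfl
    have hYS' : ∀ i, S (Y.seq.obj i) := by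
      intro i
      by_cases hi : i = Fin.last (n + 1)
      · subst hi
        exact hS _ ⟨Y, hY, rfl⟩ _ fun j hj => hYS j (by have := Fin.val_lt_last hj; lia)
      · exact hYS i (by have := Fin.val_lt_last hi; lia)
    obtain ⟨Y', rfl⟩ := AngleSeq.exists_map_eq η Y hYS'
    let g₀ : X.seq.obj' 0 ≅ (Y'.seq.obj' 0).obj := @asIso _ _ _ _ _ hg0
    let g₁ : X.seq.obj' 1 ≅ (Y'.seq.obj' 1).obj := @asIso _ _ _ _ _ hg1
    have hg : X.seq.map' 0 1 ≫ g₁.hom = g₀.hom ≫ (Y'.seq.map' 0 1).hom := g.naturality _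
    refine ⟨Y', hY, ⟨Arrow.isoMk (S.isoMk (g₀.symm ≪≫ e₀)) (S.isoMk (g₁.symm ≪≫ e₁))
      (ObjectProperty.hom_ext _ ?_)⟩⟩
    change (g₀.inv ≫ e₀.hom) ≫ f.hom = (Y'.seq.map' 0 1).hom ≫ g₁.inv ≫ e₁.hom
    rw [Category.assoc, he, Iso.inv_comp_eq, ← reassoc_of% hg, Iso.hom_inv_id_assoc]
  exists_hom X hX Y hY a b hab := by
    obtain ⟨ψ, h0, h1, Z, hZ, ⟨c⟩⟩ := h.exists_hom _ hX _ hY (S.ι.map a) (S.ι.map b) (by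
      have := congrArg S.ι.map hab
      rw [S.ι.map_comp, S.ι.map_comp] at this
      exact this)
    obtain ⟨φ, rfl⟩ := AngleSeq.exists_mapHom_eq S.ι η ψ
    have hZS : ∀ i, S (Z.seq.obj i) := by
      intro i
      by_cases hi : i = Fin.last (n + 1)
      · subst hi
        have := c.isIso_lift'
        exact hsum _ _ _ ((hT _).2 (X.seq.obj 0).property) (Y.seq.obj (Fin.last _)).property
          ⟨@asIso _ _ _ _ _ this⟩
      · have hi' : (i : ℕ) ≤ n := by have := Fin.val_lt_last hi; lia
        have := c.isIso_lift i hi'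
        exact hsum _ _ _ (X.seq.obj' (i + 1)).property (Y.seq.obj' i).property
          ⟨@asIso _ _ _ _ _ this⟩
    obtain ⟨Z', rfl⟩ := AngleSeq.exists_map_eq η Z hZS
    exact ⟨φ, S.ι.map_injective h0, S.ι.map_injective h1, Z', hZ, c.nonempty_of_map⟩

theorem IsAngulation.isAngulatedSubcategory (h : IsAngulation T n 𝒩) (hn : Odd n)
    (hd : IsDenseSubcategory S) (hS : IsCompleteSubcategory (angleTerms 𝒩) S) :
    IsAngulatedSubcategory T 𝒩 S := by
  have hE := h.isConflationClass
  have hiso := (hS.isClosedAt _).isClosedUnderIsomorphisms hE hn hd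
  have h0 := (hS.isClosedAt _).prop_of_isZero hE hn hd (isZero_zero C)
  have hsum := hS.prop_of_biprod_iso hE hn hd
  have hT := h.prop_shift_iff hn.pos hS h0
  have := hasZeroObject_fullSubcategory h0
  have := hasBinaryBiproducts_fullSubcategory fun A B hA hB => hsum A B _ hA hB ⟨Iso.refl _⟩
  have hT' : S.inverseImage T.functor = S := funext fun A => propext (hT A)
  exact ⟨hiso, inferInstance, inferInstance, T.congrFullSubcategory hT', Iso.refl _, _,
    h.restrict hn.pos hd hS hsum hT _, fun X hX => hX⟩

theorem IsAngulation.isClassifiedBy (h : IsAngulation T n 𝒩) (hn : Odd n) :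
    IsClassifiedBy (angleTerms 𝒩) {S | IsDenseSubcategory S ∧
      IsCompleteSubcategory (angleTerms 𝒩) S ∧ IsAngulatedSubcategory T 𝒩 S} ⊥ := by
  have hE := h.isConflationClass
  rw [← subgroupOf_isZero hE hn]
  refine isClassifiedBy_of hE hn (Or.inl (h.isNGenerator_isZero hn.pos))
    (fun H _ hd hc => ⟨hd, hc, h.isAngulatedSubcategory hn hd hc⟩) fun S ⟨hd, hc, _⟩ =>
    ⟨hd, fun A hA => (hc.isClosedAt _).prop_of_isZero hE hn hd hA,
      hc.prop_of_biprod_iso hE hn hd, Or.inl (hc.isClosedAt 0)⟩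

end DenseAngulatedSubcategory

end GrothendieckClassification

end

theorem corollary5p5 :
    -- (1) triangulated categories
    (∀ (C : Type u) [Category.{v} C] [HasZeroObject C] [HasShift C ℤ] [Preadditive C]
        [∀ k : ℤ, (shiftFunctor C k).Additive] [Pretriangulated C] [IsTriangulated C],
      IsClassifiedBy (triangleTerms C)
        {S | IsDenseSubcategory S ∧ S.IsTriangulated ∧ S.IsClosedUnderIsomorphisms} ⊥) ∧
    -- (2) `(n + 2)`-angulated categories, `n` odd
    (∀ (C : Type u) [Category.{v} C] [Preadditive C] [HasZeroObject C] [HasBinaryBiproducts C] (n : ℕ) (T : C ≌ C)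
        (𝒩 : Set (AngleSeq T.functor n)), Odd n → IsAngulation T n 𝒩 →
      IsClassifiedBy (angleTerms 𝒩)
        {S | IsDenseSubcategory S ∧ IsCompleteSubcategory (angleTerms 𝒩) S ∧ IsAngulatedSubcategory T 𝒩 S} ⊥ ∧
      ∀ S : ObjectProperty C, IsDenseSubcategory S → IsCompleteSubcategory (angleTerms 𝒩) S →
        IsAngulatedSubcategory T 𝒩 S) ∧
    -- (3) exact categories
    (∀ (C : Type u) [Category.{v} C] [Preadditive C] [HasZeroObject C] [HasBinaryBiproducts C]
        (ℰ : Set (ShortComplex C)) (G : ObjectProperty C), IsExactStructure ℰ →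
      (IsNGenerator (exactTerms ℰ) G →
        IsClassifiedBy (exactTerms ℰ)
          {S | IsDenseSubcategory S ∧ IsResolving (exactTerms ℰ) G S} (subgroupOf (exactTerms ℰ) G)) ∧
      (IsNCogenerator (exactTerms ℰ) G →
        IsClassifiedBy (exactTerms ℰ)
          {S | IsDenseSubcategory S ∧ IsCoresolving (exactTerms ℰ) G S} (subgroupOf (exactTerms ℰ) G))) ∧
    -- (4) extriangulated categories
    (∀ (C : Type u) [Category.{v} C] [Preadditive C] [HasZeroObject C] [HasBinaryBiproducts C]
        (𝒯 : ExtriangulatedStructure.{u, v, w} C) (G : ObjectProperty C),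
      (IsNGenerator (extriangleTerms 𝒯) G →
        IsClassifiedBy (extriangleTerms 𝒯)
          {S | IsDenseSubcategory S ∧ IsResolving (extriangleTerms 𝒯) G S}
          (subgroupOf (extriangleTerms 𝒯) G)) ∧
      (IsNCogenerator (extriangleTerms 𝒯) G →
        IsClassifiedBy (extriangleTerms 𝒯)
          {S | IsDenseSubcategory S ∧ IsCoresolving (extriangleTerms 𝒯) G S}
          (subgroupOf (extriangleTerms 𝒯) G))) ∧
    -- (5) `n`-exact categories, `n` odd
    (∀ (C : Type u) [Category.{v} C] [Preadditive C] [HasZeroObject C] [HasBinaryBiproducts C] (n : ℕ)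
        (𝒳 : Set (ComposableArrows C (n + 1))) (G : ObjectProperty C), Odd n →
        IsNExactStructure 𝒳 →
        (IsNGenerator (nExactTerms 𝒳) G ∨ IsNCogenerator (nExactTerms 𝒳) G) →
      IsClassifiedBy (nExactTerms 𝒳)
        {S | IsDenseSubcategory S ∧ IsCompleteSubcategory (nExactTerms 𝒳) S ∧ G ≤ S} (subgroupOf (nExactTerms 𝒳) G)) := by
  refine ⟨fun C => ?_, fun C _ _ _ _ n T 𝒩 hn h => ⟨h.isClassifiedBy hn, fun S hd hS =>
    h.isAngulatedSubcategory hn hd hS⟩, fun C _ _ _ _ ℰ G h => ⟨fun hG => ?_, fun hG => ?_⟩,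
    fun C _ _ _ _ 𝒯 G => ⟨fun hG => ?_, fun hG => ?_⟩, fun C _ _ _ _ n 𝒳 G hn h hG => ?_⟩
  · intros
    exact isClassifiedBy_triangulated
  · exact isClassifiedBy_resolving h.isConflationClass hG
  · exact isClassifiedBy_coresolving h.isConflationClass hG
  · exact isClassifiedBy_resolving 𝒯.isConflationClass hG
  · exact isClassifiedBy_coresolving 𝒯.isConflationClass hG
  · exact isClassifiedBy_complete (h.isConflationClass hn.pos) hn hG
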